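/- Let $(A,\mathfrak m)$ be a Gorenstein local ring, i.e. a commutative Noetherian local ring of finite injective dimension over itself. Let $\mathrm{CM}(A)$ be the category of maximal Cohen--Macaulay (MCM) $A$-modules, i.e. the finitely generated modules $M$ with $M=0$ or $\operatorname{depth} M=\dim A$, and let $\mathrm{ICM}(A)$ be its set of isomorphism classes, $\langle M\rangle$ being the class of $M$. Let $\underline{\mathrm{CM}}(A)$ be the stable category: it has the same objects, and morphisms $\operatorname{Hom}_A(M,N)/P(M,N)$, where $P(M,N)$ is the set of maps that factor through a finitely generated free module. Let $\underline{\mathrm{ICM}}(A)$ be its set of isomorphism classes, $[M]$ being the class of $M$. For $M\in\mathrm{CM}(A)$ choose a minimal surjection $\varepsilon\colon G\to M^*=\operatorname{Hom}_A(M,A)$ with $G$ finitely generated free, let $i\colon M\to M^{**}\to G^*=Q$ be the map induced by $\varepsilon^*$, and let $p\colon Q\to\Omega^{-1}(M)=\operatorname{coker} i$ be the co-syzygy of $M$. A morphism $f\colon M\to N$ extends to a map of these sequences, and this makes $\Omega^{-1}$ a functor on the stable category. For $f\colon M\to N$ in $\mathrm{CM}(A)$ let $C(f)$ be the pushout of $f$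 and $i$, with $i'\colon N\to C(f)$ and with $p'\colon C(f)\to\Omega^{-1}(M)$ induced by $0$ on $N$ and by $p$ on $Q$; the image of $M\xrightarrow{f}N\xrightarrow{i'}C(f)\xrightarrow{-p'}\Omega^{-1}(M)$ in $\underline{\mathrm{CM}}(A)$ is a basic exact triangle, and the exact triangles are those isomorphic to a basic one. A function $\xi\colon\mathrm{ICM}(A)\to\mathbb Z$ is a pre-triangle function if, for all MCM modules: (1) $\xi(\langle M\rangle)\ge 0$; (2) $\xi(\langle M\rangle)=0$ if and only if $M$ is free; (3) $\xi(\langle M_1\oplus M_2\rangle)=\xi(\langle M_1\rangle)+\xi(\langle M_2\rangle)$; (4) $\xi(\langle N\rangle)\le\xi(\langle M\rangle)+\xi(\langle L\rangle)$ for every exact sequence $0\to M\to N\to L\to 0$ in $\mathrm{CM}(A)$. A function $\xi'\colon\underline{\mathrm{ICM}}(A)\to\mathbb Z$ is a triangle function if: (1) $\xi'([M])\ge 0$; (2) $\xi'([M])=0$ if and only if $M=0$ in $\underline{\mathrm{CM}}(A)$; (3) $\xi'([M_1\oplus M_2])=\xi'([M_1])+\xi'([M_2])$; (4) for every exact triangle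 $M\to N\to L\to\Omega^{-1}(M)$ one has $\xi'([N])\le\xi'([M])+\xi'([L])$, $\ \xi'([L])\le\xi'([N])+\xi'([\Omega^{-1}(M)])$ and $\xi'([\Omega^{-1}(M)])\le\xi'([L])+\xi'([\Omega^{-1}(N)])$. Theorem. The co-syzygy of an MCM $A$-module is again MCM, and for every pre-triangle function $\xi\colon\mathrm{ICM}(A)\to\mathbb Z$ the assignment $\xi'([M])=\xi(\langle M\rangle)$ is a well-defined function $\underline{\mathrm{ICM}}(A)\to\mathbb Z$, and it is a triangle function. -/

import Mathlib

open CategoryTheory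

universe u

namespace StableCM

section Basic

variable (A : Type u) [CommRing A]

/-- A Noetherian (local) ring is Gorenstein if it has finite injective dimension as a module over
itself. -/
def IsGorenstein : Prop :=
  injectiveDimension (ModuleCat.of A A) ≠ ⊤

variable [IsLocalRing A]

/-- Maximal Cohen-Macaulay modules: finitely generated modules that are zero, or that admit a
regular sequence of length `dim A` in the maximal ideal (that is, `depth M = dim A`). -/
def isMCM : ObjectProperty (ModuleCat.{u} A) := fun M =>
  Module.Finite A M ∧
    (Subsingleton M ∨
      ∃ rs : List A, (rs.length : WithBot ℕ∞) = ringKrullDim A ∧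
        (∀ r ∈ rs, r ∈ IsLocalRing.maximalIdeal A) ∧ RingTheory.Sequence.IsRegular M rs)

/-- The category `CM(A)` of maximal Cohen-Macaulay modules, full in the category of modules. -/
abbrev CM : Type (u + 1) := (isMCM A).FullSubcategory

instance (M : CM A) : Module.Finite A M.obj := M.property.1

/-- Isomorphism classes of maximal Cohen-Macaulay modules. -/
abbrev ICM : Type (u + 1) := _root_.Quotient (isIsomorphicSetoid (CM A))

variable {A}

/-- The isomorphism class `<M>` of `M` in `CM(A)`. -/
def ICM.mk (M : CM A) : ICM A := Quotient.mk (isIsomorphicSetoid (CM A)) M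

end Basic

section DirectSum

variable {A : Type u} [CommRing A] [IsLocalRing A] [IsNoetherianRing A]

open Abelian in
theorem isMCM_prod (M N : ModuleCat.{u} A) (hM : isMCM A M) (hN : isMCM A N) :
    isMCM A (ModuleCat.of A (M × N)) := by
  have := hM.1
  have := hN.1
  refine ⟨inferInstanceAs (Module.Finite A (M × N)), ?_⟩
  rcases hM.2 with h | ⟨rs, hl, hm, hr⟩
  · rcases hN.2 with h' | ⟨rs, hl, hm, hr⟩
    · exact Or.inl (inferInstanceAs (Subsingleton (M × N)))
    · refine Or.inr ⟨rs, hl, hm, ?_⟩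
      let e : N ≃ₗ[A] (M × N) := LinearEquiv.ofBijective (LinearMap.inr A M N)
        ⟨LinearMap.inr_injective, fun x => ⟨x.2, Prod.ext (Subsingleton.elim _ _) rfl⟩⟩
      exact (e.isRegular_congr rs).1 hr
  · rcases hN.2 with h' | ⟨rs', hl', hm', hr'⟩
    · refine Or.inr ⟨rs, hl, hm, ?_⟩
      let e : M ≃ₗ[A] (M × N) := LinearEquiv.ofBijective (LinearMap.inl A M N)
        ⟨LinearMap.inl_injective, fun x => ⟨x.1, Prod.ext rfl (Subsingleton.elim _ _)⟩⟩
      exact (e.isRegular_congr rs).1 hr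
    · have hlt : ∀ (X : ModuleCat.{u} A), Module.Finite A X → Nontrivial X →
          IsLocalRing.maximalIdeal A • (⊤ : Submodule A X) < ⊤ := fun X _ _ =>
        (Submodule.top_ne_ideal_smul_of_le_jacobson_annihilator
          (IsLocalRing.maximalIdeal_le_jacobson _)).symm.lt_top
      have hMn : Nontrivial M := hr.nontrivial
      have hNn : Nontrivial N := hr'.nontrivial
      have hll : rs'.length = rs.length := by
        have := hl'.trans hl.symm
        exact_mod_cast this
      have h1 := ((ModuleCat.exists_isRegular_tfae (IsLocalRing.maximalIdeal A) rs.length M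
        (hlt M hM.1 hMn)).out 3 1 rfl rfl).1 ⟨rs, rfl, hm, hr⟩
      have h2 := ((ModuleCat.exists_isRegular_tfae (IsLocalRing.maximalIdeal A) rs.length N
        (hlt N hN.1 hNn)).out 3 1 rfl rfl).1 ⟨rs', hll, hm', hr'⟩
      have hfin : Module.Finite A (ModuleCat.of A (M × N)) :=
        inferInstanceAs (Module.Finite A (M × N))
      obtain ⟨qs, h3, h4, h5⟩ := ((ModuleCat.exists_isRegular_tfae (IsLocalRing.maximalIdeal A)
        rs.length (ModuleCat.of A (M × N)) (hlt _ hfin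
          (inferInstanceAs (Nontrivial (M × N))))).out 3 1 rfl rfl).2 (by
        intro i hi
        have := h1 i hi
        have := h2 i hi
        refine ⟨fun x y => ?_⟩
        have key : ∀ z : Ext (ModuleCat.of A (Shrink.{u} (A ⧸ IsLocalRing.maximalIdeal A)))
            (ModuleCat.of A (M × N)) i, z = 0 := by
          intro z
          have hid : 𝟙 (ModuleCat.of A (M × N)) =
              ModuleCat.ofHom (LinearMap.fst A M N) ≫ ModuleCat.ofHom (LinearMap.inl A M N) +
              ModuleCat.ofHom (LinearMap.snd A M N) ≫ ModuleCat.ofHom (LinearMap.inr A M N) := by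
            ext x <;> simp
          have e1 : z = z.comp (Ext.mk₀ (𝟙 (ModuleCat.of A (M × N)))) (add_zero i) := by simp
          rw [e1, hid, Ext.mk₀_add, Ext.comp_add, ← Ext.mk₀_comp_mk₀, ← Ext.mk₀_comp_mk₀,
            ← Ext.comp_assoc z _ _ (add_zero i) (add_zero 0) (by simp),
            ← Ext.comp_assoc z _ _ (add_zero i) (add_zero 0) (by simp),
            Subsingleton.elim (z.comp (Ext.mk₀ (ModuleCat.ofHom (LinearMap.fst A M N)))
              (add_zero i)) 0,
            Subsingleton.elim (z.comp (Ext.mk₀ (ModuleCat.ofHom (LinearMap.snd A M N)))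
              (add_zero i)) 0]
          simp
        rw [key x, key y])
      exact Or.inr ⟨qs, by rw [h3, hl], h4, h5⟩

/-- The direct sum of two maximal Cohen-Macaulay modules. -/
def CM.sum (M N : CM A) : CM A :=
  ⟨ModuleCat.of A (M.obj × N.obj), isMCM_prod _ _ M.property N.property⟩

/-- Pre-triangle functions on isomorphism classes of maximal Cohen-Macaulay modules. -/
structure IsPreTriangleFunction (ξ : ICM A → ℤ) : Prop where
  nonneg : ∀ M : CM A, 0 ≤ ξ (ICM.mk M)
  eq_zero_iff : ∀ M : CM A, ξ (ICM.mk M) = 0 ↔ Module.Free A M.obj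
  add : ∀ M N : CM A, ξ (ICM.mk (M.sum N)) = ξ (ICM.mk M) + ξ (ICM.mk N)
  subadd : ∀ (M N L : CM A) (f : M.obj →ₗ[A] N.obj) (g : N.obj →ₗ[A] L.obj),
    Function.Injective f → Function.Exact f g → Function.Surjective g →
      ξ (ICM.mk N) ≤ ξ (ICM.mk M) + ξ (ICM.mk L)

end DirectSum

section Stable

variable (A : Type u) [CommRing A]

/-- `P(M, N)`: linear maps that factor through a finitely generated free module. -/
def FactorsThroughFree {A : Type u} [CommRing A] {M N : Type u} [AddCommGroup M] [Module A M]
    [AddCommGroup N] [Module A N] (f : M →ₗ[A] N) : Prop :=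
  ∃ (n : ℕ) (g : M →ₗ[A] (Fin n → A)) (h : (Fin n → A) →ₗ[A] N), h ∘ₗ g = f

theorem factorsThroughFree_zero {A : Type u} [CommRing A] {M N : Type u} [AddCommGroup M]
    [Module A M] [AddCommGroup N] [Module A N] : FactorsThroughFree (0 : M →ₗ[A] N) :=
  ⟨0, 0, 0, by simp⟩

theorem FactorsThroughFree.add {A : Type u} [CommRing A] {M N : Type u} [AddCommGroup M]
    [Module A M] [AddCommGroup N] [Module A N] {f g : M →ₗ[A] N} (hf : FactorsThroughFree f)
    (hg : FactorsThroughFree g) : FactorsThroughFree (f + g) := by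
  obtain ⟨n, a, b, rfl⟩ := hf
  obtain ⟨m, c, d, rfl⟩ := hg
  let e : (Fin (n + m) → A) ≃ₗ[A] (Fin n → A) × (Fin m → A) :=
    (LinearEquiv.funCongrLeft A A finSumFinEquiv).trans
      (LinearEquiv.sumArrowLequivProdArrow (Fin n) (Fin m) A A)
  refine ⟨n + m, e.symm.toLinearMap ∘ₗ a.prod c, (b.coprod d) ∘ₗ e.toLinearMap, ?_⟩
  ext x
  simp

variable [IsLocalRing A]

/-- Two morphisms of `CM(A)` are identified if their difference lies in `P(M, N)`. -/
def stableRel : HomRel (CM A) := fun _ _ f g => FactorsThroughFree (f.hom.hom - g.hom.hom)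

/-- The relation is a congruence, so that morphisms of the quotient category by it are exactly the
classes modulo `P(M, N)`. -/
instance : Congruence (stableRel A) where
  equivalence :=
    { refl := fun f => by
        rw [stableRel, sub_self]
        exact factorsThroughFree_zero
      symm := fun {f g} h => by
        obtain ⟨n, a, b, h⟩ := h
        exact ⟨n, a, -b, by rw [LinearMap.neg_comp, h, neg_sub]⟩
      trans := fun {f g k} h h' => by
        have := FactorsThroughFree.add h h'
        rwa [sub_add_sub_cancel] at this }
  comp_left := by
    intro _ _ _ f g g' h
    obtain ⟨n, a, b, h⟩ := h
    exact ⟨n, a ∘ₗ f.hom.hom, b, by rw [← LinearMap.comp_assoc, h]; rfl⟩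
  comp_right := by
    intro _ _ _ f f' g h
    obtain ⟨n, a, b, h⟩ := h
    refine ⟨n, a, g.hom.hom ∘ₗ b, ?_⟩
    rw [LinearMap.comp_assoc, h, LinearMap.comp_sub]
    rfl

/-- The stable category of maximal Cohen-Macaulay modules: the objects of `CM(A)`, with
`Hom(M, N) / P(M, N)` as morphisms from `M` to `N`. -/
abbrev Stable : Type (u + 1) := CategoryTheory.Quotient (stableRel A)

/-- The projection `CM(A) ⥤ Stable(A)`. -/
abbrev proj : CM A ⥤ Stable A := CategoryTheory.Quotient.functor (stableRel A)

/-- Isomorphism classes in the stable category. -/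
abbrev StableICM : Type (u + 1) := _root_.Quotient (isIsomorphicSetoid (Stable A))

variable {A}

/-- The isomorphism class `[M]` of `M` in the stable category. -/
def StableICM.mk (M : Stable A) : StableICM A := Quotient.mk (isIsomorphicSetoid (Stable A)) M

end Stable

section Cosyzygy

variable (A : Type u) [CommRing A] [IsNoetherianRing A]
variable (M : Type u) [AddCommGroup M] [Module A M] [Module.Finite A M]

/-- `μ(M*)`, the minimal number of generators of the dual of `M`. -/
noncomputable def dualRank : ℕ := (⊤ : Submodule A (Module.Dual A M)).spanFinrank

theorem exists_dualGens : ∃ ε : Fin (dualRank A M) → Module.Dual A M,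
    Submodule.span A (Set.range ε) = ⊤ := by
  obtain ⟨s, hs, hspan⟩ := Submodule.FG.exists_span_finset_card_eq_spanFinrank
    (Module.Finite.fg_top (R := A) (M := Module.Dual A M))
  refine ⟨fun i => (s.equivFinOfCardEq hs).symm i, ?_⟩
  have h : Set.range (fun i => (((s.equivFinOfCardEq hs).symm i : s) : Module.Dual A M)) = s := by
    ext x
    constructor
    · rintro ⟨i, rfl⟩
      exact ((s.equivFinOfCardEq hs).symm i).2
    · intro hx
      exact ⟨s.equivFinOfCardEq hs ⟨x, hx⟩, by simp⟩
  exact (congrArg (Submodule.span A) h).trans hspan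

/-- A minimal system of generators of `M*`, i.e. a minimal surjection `ε : A^n → M*`. -/
noncomputable def dualGens : Fin (dualRank A M) → Module.Dual A M :=
  (exists_dualGens A M).choose

/-- The map `M → M** → (A^n)* = A^n` dual to the minimal surjection `ε : A^n → M*`. -/
noncomputable def cosyzygyIn : M →ₗ[A] (Fin (dualRank A M) → A) :=
  LinearMap.pi (dualGens A M)

/-- The co-syzygy `Ω⁻¹(M)`, the cokernel of `M → A^n`. -/
abbrev Cosyzygy : Type u := (Fin (dualRank A M) → A) ⧸ LinearMap.range (cosyzygyIn A M)

/-- The projection `A^n → Ω⁻¹(M)`. -/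
noncomputable def cosyzygyOut : (Fin (dualRank A M) → A) →ₗ[A] Cosyzygy A M :=
  Submodule.mkQ _

variable {A M}

/-- Every map from `M` to a finitely generated free module extends along `M → A^n`. -/
theorem exists_extend {n : ℕ} (g : M →ₗ[A] (Fin n → A)) :
    ∃ b : (Fin (dualRank A M) → A) →ₗ[A] (Fin n → A), b ∘ₗ cosyzygyIn A M = g := by
  have h1 : ∀ φ : Module.Dual A M, ∃ β : (Fin (dualRank A M) → A) →ₗ[A] A,
      β ∘ₗ cosyzygyIn A M = φ := by
    intro φ
    have hφ : φ ∈ Submodule.span A (Set.range (dualGens A M)) := by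
      rw [dualGens, (exists_dualGens A M).choose_spec]
      trivial
    induction hφ using Submodule.span_induction with
    | mem x hx =>
      obtain ⟨i, rfl⟩ := hx
      exact ⟨LinearMap.proj i, rfl⟩
    | zero => exact ⟨0, by simp⟩
    | add x y _ _ hx hy =>
      obtain ⟨a, rfl⟩ := hx
      obtain ⟨b, rfl⟩ := hy
      exact ⟨a + b, LinearMap.add_comp _ _ _⟩
    | smul r x _ hx =>
      obtain ⟨a, rfl⟩ := hx
      exact ⟨r • a, LinearMap.smul_comp _ _ _⟩
  choose β hβ using fun i => h1 (LinearMap.proj i ∘ₗ g)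
  refine ⟨LinearMap.pi β, ?_⟩
  ext m i
  exact LinearMap.congr_fun (hβ i) m

variable {N : Type u} [AddCommGroup N] [Module A N] [Module.Finite A N]

/-- `c : Ω⁻¹(M) → Ω⁻¹(N)` is induced by `f : M → N` if it completes `f` to a morphism of the
sequences `M → A^m → Ω⁻¹(M)` and `N → A^n → Ω⁻¹(N)`. -/
def IsInduced (f : M →ₗ[A] N) (c : Cosyzygy A M →ₗ[A] Cosyzygy A N) : Prop :=
  ∃ b : (Fin (dualRank A M) → A) →ₗ[A] (Fin (dualRank A N) → A),
    b ∘ₗ cosyzygyIn A M = cosyzygyIn A N ∘ₗ f ∧ c ∘ₗ cosyzygyOut A M = cosyzygyOut A N ∘ₗ b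

theorem exists_isInduced (f : M →ₗ[A] N) : ∃ c, IsInduced f c := by
  obtain ⟨b, hb⟩ := exists_extend (cosyzygyIn A N ∘ₗ f)
  refine ⟨Submodule.mapQ _ _ b ?_, b, hb, LinearMap.ext fun _ => rfl⟩
  rintro _ ⟨m, rfl⟩
  exact ⟨f m, (LinearMap.congr_fun hb m).symm⟩

theorem factors_of_isInduced {f f' : M →ₗ[A] N} {c c' : Cosyzygy A M →ₗ[A] Cosyzygy A N}
    (h : IsInduced f c) (h' : IsInduced f' c') (hf : FactorsThroughFree (f - f')) :
    FactorsThroughFree (c - c') := by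
  obtain ⟨b, hb, hc⟩ := h
  obtain ⟨b', hb', hc'⟩ := h'
  obtain ⟨n, g, k, hgk⟩ := hf
  obtain ⟨e, he⟩ := exists_extend g
  let t := b - b' - cosyzygyIn A N ∘ₗ k ∘ₗ e
  have ht : LinearMap.range (cosyzygyIn A M) ≤ LinearMap.ker t := by
    rintro _ ⟨m, rfl⟩
    have h1 := LinearMap.congr_fun hb m
    have h2 := LinearMap.congr_fun hb' m
    have h3 := LinearMap.congr_fun he m
    have h4 := LinearMap.congr_fun hgk m
    simp only [LinearMap.comp_apply, LinearMap.sub_apply] at h1 h2 h3 h4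
    simp [t, h1, h2, h3, h4]
  refine ⟨dualRank A N, Submodule.liftQ _ t ht, cosyzygyOut A N, ?_⟩
  refine Submodule.linearMap_qext _ ?_
  ext1 i
  have h1 := LinearMap.congr_fun hc
  have h2 := LinearMap.congr_fun hc'
  ext
  have h3 : ∀ x, cosyzygyOut A N (cosyzygyIn A N x) = 0 := fun x =>
    (Submodule.Quotient.mk_eq_zero _).2 ⟨x, rfl⟩
  simp only [LinearMap.comp_apply, cosyzygyOut, Submodule.mkQ_apply] at h1 h2 h3
  simp [t, h1, h2, h3, cosyzygyOut]

/-- A chosen map `Ω⁻¹(M) → Ω⁻¹(N)` induced by `f`; its stable class does not depend on the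
choice. -/
noncomputable def cosyzygyMap (f : M →ₗ[A] N) : Cosyzygy A M →ₗ[A] Cosyzygy A N :=
  (exists_isInduced f).choose

theorem cosyzygyMap_isInduced (f : M →ₗ[A] N) : IsInduced f (cosyzygyMap f) :=
  (exists_isInduced f).choose_spec

end Cosyzygy

section Triangles

variable (A : Type u) [CommRing A] [IsLocalRing A] [IsNoetherianRing A]

/-- Co-syzygies of maximal Cohen-Macaulay modules are maximal Cohen-Macaulay. -/
def CosyzygyClosed : Prop :=
  ∀ M : CM A, isMCM A (ModuleCat.of A (Cosyzygy A M.obj))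

variable {A}

/-- `Ω⁻¹(M)` as an object of `CM(A)`. -/
noncomputable def CosyzygyClosed.obj (hΩ : CosyzygyClosed A) (M : CM A) : CM A :=
  ⟨ModuleCat.of A (Cosyzygy A M.obj), hΩ M⟩

/-- A map induced on co-syzygies by a morphism of `CM(A)`. -/
noncomputable def CosyzygyClosed.map (hΩ : CosyzygyClosed A) {M N : CM A} (f : M ⟶ N) :
    hΩ.obj M ⟶ hΩ.obj N :=
  ObjectProperty.homMk (ModuleCat.ofHom (cosyzygyMap f.hom.hom))

theorem CosyzygyClosed.proj_map_eq (hΩ : CosyzygyClosed A) {M N : CM A} (f g : M ⟶ N)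
    (c : hΩ.obj M ⟶ hΩ.obj N) (hc : IsInduced g.hom.hom c.hom.hom)
    (hfg : FactorsThroughFree (f.hom.hom - g.hom.hom)) :
    (proj A).map (hΩ.map f) = (proj A).map c :=
  CategoryTheory.Quotient.sound _
    (factors_of_isInduced (cosyzygyMap_isInduced f.hom.hom) hc hfg)

/-- The translation functor `Ω⁻¹` of the stable category. -/
noncomputable def translation (hΩ : CosyzygyClosed A) : Stable A ⥤ Stable A :=
  CategoryTheory.Quotient.lift (stableRel A)
    { obj := fun M => (proj A).obj (hΩ.obj M)
      map := fun f => (proj A).map (hΩ.map f)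
      map_id := fun M => by
        rw [← (proj A).map_id]
        refine hΩ.proj_map_eq _ (𝟙 M) _ ⟨LinearMap.id, rfl, rfl⟩ ?_
        rw [sub_self]
        exact factorsThroughFree_zero
      map_comp := fun {M N L} f g => by
        rw [← (proj A).map_comp]
        refine hΩ.proj_map_eq _ (f ≫ g) _ ?_ ?_
        · obtain ⟨b, hb, hc⟩ := cosyzygyMap_isInduced f.hom.hom
          obtain ⟨b', hb', hc'⟩ := cosyzygyMap_isInduced g.hom.hom
          refine ⟨b' ∘ₗ b, ?_, ?_⟩
          · change (b' ∘ₗ b) ∘ₗ _ = cosyzygyIn A L.obj ∘ₗ (g.hom.hom ∘ₗ f.hom.hom)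
            rw [LinearMap.comp_assoc, hb, ← LinearMap.comp_assoc, hb', LinearMap.comp_assoc]
          · change (cosyzygyMap g.hom.hom ∘ₗ cosyzygyMap f.hom.hom) ∘ₗ _ = _
            rw [LinearMap.comp_assoc, hc, ← LinearMap.comp_assoc, hc', LinearMap.comp_assoc]
        · rw [sub_self]
          exact factorsThroughFree_zero }
    (fun _ _ f g h => hΩ.proj_map_eq f g _ (cosyzygyMap_isInduced g.hom.hom) h)

/-- Sequences `M ⟶ N ⟶ L ⟶ Ω⁻¹(M)` in the stable category. -/
structure Triangle (hΩ : CosyzygyClosed A) where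
  /-- the first object -/
  M : Stable A
  /-- the second object -/
  N : Stable A
  /-- the third object -/
  L : Stable A
  /-- the first morphism -/
  f : M ⟶ N
  /-- the second morphism -/
  g : N ⟶ L
  /-- the third morphism -/
  h : L ⟶ (translation hΩ).obj M

/-- Isomorphism of triangles. -/
def Triangle.Isomorphic {hΩ : CosyzygyClosed A} (S T : Triangle hΩ) : Prop :=
  ∃ (a : S.M ≅ T.M) (b : S.N ≅ T.N) (c : S.L ≅ T.L),
    S.f ≫ b.hom = a.hom ≫ T.f ∧ S.g ≫ c.hom = b.hom ≫ T.g ∧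
      S.h ≫ (translation hΩ).map a.hom = c.hom ≫ T.h

/-- Basic exact triangles: `C` is the pushout of `f : M → N` and `i : M → Q = A^n`, the map
`p' : C → Ω⁻¹(M)` is `0` on `N` and the projection `p : Q → Ω⁻¹(M)` on `Q`, and the triangle is
the image of `M → N → C → Ω⁻¹(M)` with maps `f`, `i'`, `-p'`. -/
def Triangle.IsBasic {hΩ : CosyzygyClosed A} (T : Triangle hΩ) : Prop :=
  ∃ (M N C : CM A) (f : M ⟶ N) (i' : N ⟶ C) (p' : C ⟶ hΩ.obj M)
    (q : ModuleCat.of A (Fin (dualRank A M.obj) → A) ⟶ C.obj),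
    IsPushout f.hom (ModuleCat.ofHom (cosyzygyIn A M.obj)) i'.hom q ∧
    i'.hom ≫ p'.hom = 0 ∧
    q ≫ p'.hom = ModuleCat.ofHom (cosyzygyOut A M.obj) ∧
    T = { M := (proj A).obj M, N := (proj A).obj N, L := (proj A).obj C,
          f := (proj A).map f, g := (proj A).map i',
          h := (proj A).map (ObjectProperty.homMk (-p'.hom)) }

/-- Exact triangles are the triangles isomorphic to a basic one. -/
def Triangle.IsExact {hΩ : CosyzygyClosed A} (T : Triangle hΩ) : Prop :=
  ∃ S : Triangle hΩ, S.IsBasic ∧ T.Isomorphic S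

/-- Triangle functions on isomorphism classes of the stable category. -/
structure IsTriangleFunction (hΩ : CosyzygyClosed A) (ξ : StableICM A → ℤ) : Prop where
  nonneg : ∀ M : Stable A, 0 ≤ ξ (StableICM.mk M)
  eq_zero_iff : ∀ M : Stable A, ξ (StableICM.mk M) = 0 ↔ Limits.IsZero M
  add : ∀ M N : CM A, ξ (StableICM.mk ((proj A).obj (M.sum N))) =
    ξ (StableICM.mk ((proj A).obj M)) + ξ (StableICM.mk ((proj A).obj N))
  subadd₁ : ∀ T : Triangle hΩ, T.IsExact →
    ξ (StableICM.mk T.N) ≤ ξ (StableICM.mk T.M) + ξ (StableICM.mk T.L)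
  subadd₂ : ∀ T : Triangle hΩ, T.IsExact →
    ξ (StableICM.mk T.L) ≤
      ξ (StableICM.mk T.N) + ξ (StableICM.mk ((translation hΩ).obj T.M))
  subadd₃ : ∀ T : Triangle hΩ, T.IsExact →
    ξ (StableICM.mk ((translation hΩ).obj T.M)) ≤
      ξ (StableICM.mk T.L) + ξ (StableICM.mk ((translation hΩ).obj T.N))

end Triangles

end StableCM

/-!
Choose a maximal regular sequence `x`, of length `dim A`. Bass' argument kills `Ext^i(-, A)` above
that length, which makes `A/xA` injective over itself and `Ext^i(M, A)` zero for `i > 0` and `M`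
maximal Cohen-Macaulay. Therefore functionals on `M/xM` lift to functionals on `M`, and those
separate the points of `M/xM`: the map `M → A^n` stays injective modulo `x`, so it is injective and
`x` is regular on its cokernel.

A stable isomorphism becomes an isomorphism after adding free modules, which `ξ` does not see. In
the same way the three inequalities come from honest short exact sequences attached to the pushout
`C` of `f : M → N` and `M → Q`, namely `0 → M → N ⊕ Q → C → 0`, `0 → N → C → Ω⁻¹(M) → 0` and
`0 → C → Ω⁻¹(M) ⊕ Q' → Ω⁻¹(N) → 0`, where `N → Q'` has cokernel `Ω⁻¹(N)`.
-/

namespace StableCM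

open Abelian IsLocalRing RingTheory.Sequence Module Pointwise

section Ext

variable {C : Type*} [Category* C] [Abelian C] [HasExt C] {S : ShortComplex C}

theorem subsingleton_ext_of_iso {X X' : C} (e : X ≅ X') (Y : C) (i : ℕ)
    [Subsingleton (Ext X' Y i)] : Subsingleton (Ext X Y i) :=
  (((extFunctor i).mapIso e.op).app Y).addCommGroupIsoToAddEquiv.toEquiv.subsingleton_congr.1 ‹_›

theorem surjective_precomp_of_shortExact (hS : S.ShortExact) {Y : C} {i : ℕ}
    (h₃ : Subsingleton (Ext S.X₃ Y (i + 1))) :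
    Function.Surjective ((Ext.mk₀ S.f).precomp Y (zero_add i)) := fun z =>
  Ext.contravariant_sequence_exact₁ hS Y z (add_comm 1 i) (h₃.elim _ _)

theorem subsingleton_ext_X₁_of_shortExact (hS : S.ShortExact) {Y : C} {i : ℕ}
    (h₂ : Subsingleton (Ext S.X₂ Y i)) (h₃ : Subsingleton (Ext S.X₃ Y (i + 1))) :
    Subsingleton (Ext S.X₁ Y i) :=
  @Function.Surjective.subsingleton _ _ _ h₂ (surjective_precomp_of_shortExact hS h₃)

theorem subsingleton_ext_X₂_of_shortExact (hS : S.ShortExact) {Y : C} {i : ℕ}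
    (h₁ : Subsingleton (Ext S.X₁ Y i)) (h₃ : Subsingleton (Ext S.X₃ Y i)) :
    Subsingleton (Ext S.X₂ Y i) := by
  refine subsingleton_of_forall_eq 0 fun z => ?_
  obtain ⟨w, rfl⟩ := Ext.contravariant_sequence_exact₂ hS Y z (h₁.elim _ _)
  rw [h₃.elim w 0, Ext.comp_zero]

theorem surjective_postcomp_of_shortExact (hS : S.ShortExact) {X : C} {i : ℕ}
    (h₁ : Subsingleton (Ext X S.X₁ (i + 1))) :
    Function.Surjective ((Ext.mk₀ S.g).postcomp X (add_zero i)) := fun z =>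
  Ext.covariant_sequence_exact₃ X hS z rfl (h₁.elim _ _)

theorem subsingleton_ext_X₃_of_shortExact (hS : S.ShortExact) {X : C} {i : ℕ}
    (h₂ : Subsingleton (Ext X S.X₂ i)) (h₁ : Subsingleton (Ext X S.X₁ (i + 1))) :
    Subsingleton (Ext X S.X₃ i) :=
  @Function.Surjective.subsingleton _ _ _ h₂ (surjective_postcomp_of_shortExact hS h₁)

theorem exists_comp_eq_of_surjective_precomp {X' X Y : C} {g : X' ⟶ X}
    (hg : Function.Surjective ((Ext.mk₀ g).precomp Y (zero_add 0))) (φ : X' ⟶ Y) :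
    ∃ ψ : X ⟶ Y, g ≫ ψ = φ := by
  obtain ⟨w, hw⟩ := hg (Ext.mk₀ φ)
  obtain ⟨ψ, rfl⟩ := (Ext.mk₀_bijective _ _).2 w
  exact ⟨ψ, (Ext.mk₀_bijective _ _).1 ((Ext.mk₀_comp_mk₀ g ψ).symm.trans hw)⟩

theorem exists_comp_eq_of_surjective_postcomp {X Y Y' : C} {g : Y ⟶ Y'}
    (hg : Function.Surjective ((Ext.mk₀ g).postcomp X (add_zero 0))) (φ : X ⟶ Y') :
    ∃ ψ : X ⟶ Y, ψ ≫ g = φ := by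
  obtain ⟨w, hw⟩ := hg (Ext.mk₀ φ)
  obtain ⟨ψ, rfl⟩ := (Ext.mk₀_bijective _ _).2 w
  exact ⟨ψ, (Ext.mk₀_bijective _ _).1 ((Ext.mk₀_comp_mk₀ ψ g).symm.trans hw)⟩

theorem surjective_precomp_X₃_of_shortExact (hS : S.ShortExact) {X' X : C} (g : X' ⟶ X) {i : ℕ}
    (hzero : ∀ w : Ext X S.X₁ (i + 1), w.comp (Ext.mk₀ S.f) (add_zero _) = 0)
    (hvan : Subsingleton (Ext X' S.X₂ i))
    (hext : Function.Surjective ((Ext.mk₀ g).precomp S.X₁ (zero_add (i + 1)))) :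
    Function.Surjective ((Ext.mk₀ g).precomp S.X₃ (zero_add i)) := by
  intro z
  have extClass_injective : ∀ y : Ext X' S.X₃ i, y.comp hS.extClass rfl = 0 → y = 0 := by
    intro y hy
    obtain ⟨x, rfl⟩ := Ext.covariant_sequence_exact₃ X' hS y rfl hy
    rw [Subsingleton.elim x 0, Ext.zero_comp]
  obtain ⟨w, hw⟩ := hext (z.comp hS.extClass rfl)
  obtain ⟨v, rfl⟩ := Ext.covariant_sequence_exact₁ X hS w (hzero w) rfl
  refine ⟨v, sub_eq_zero.1 (extClass_injective _ ?_)⟩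
  rw [sub_eq_add_neg, Ext.add_comp, Ext.neg_comp, ← sub_eq_add_neg, sub_eq_zero, ← hw]
  exact Ext.comp_assoc _ v _ (zero_add i) rfl (by omega)

end Ext

section LinearShortExact

variable {A : Type*} [CommRing A] {M N L : Type*} [AddCommGroup M] [Module A M]
  [AddCommGroup N] [Module A N] [AddCommGroup L] [Module A L]

/-- `0 → M → N → L → 0` is a short exact sequence of modules. -/
structure IsShortExact (f : M →ₗ[A] N) (g : N →ₗ[A] L) : Prop where
  injective : Function.Injective f
  exact : Function.Exact f g
  surjective : Function.Surjective g

theorem isShortExact_mkQ_range {f : M →ₗ[A] N} (hf : Function.Injective f) :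
    IsShortExact f (LinearMap.range f).mkQ :=
  ⟨hf, LinearMap.exact_map_mkQ_range f, Submodule.mkQ_surjective _⟩

end LinearShortExact

section Bass

variable {A : Type u} [CommRing A]

theorem IsShortExact.shortExact {M N L : Type u} [AddCommGroup M] [Module A M] [AddCommGroup N]
    [Module A N] [AddCommGroup L] [Module A L] {f : M →ₗ[A] N} {g : N →ₗ[A] L}
    (h : IsShortExact f g) :
    (ModuleCat.shortComplexOfCompEqZero f g h.exact.linearMap_comp_eq_zero).ShortExact :=
  ModuleCat.shortComplex_shortExact _ h.exact h.injective h.surjective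

theorem isSMulRegular_quotient_of_notMem {p : Ideal A} [p.IsPrime] {x : A} (hx : x ∉ p) :
    IsSMulRegular (A ⧸ p) x :=
  (isSMulRegular_algebraMap_iff (A ⧸ p)).1
    (IsRegular.of_ne_zero (mt Ideal.Quotient.eq_zero_iff_mem.1 hx)).left.isSMulRegular

theorem subsingleton_ext_of_forall_quotient_prime [IsNoetherianRing A] {Y : ModuleCat.{u} A}
    {i : ℕ} (h : ∀ p : Ideal A, p.IsPrime → Subsingleton (Ext (ModuleCat.of A (A ⧸ p)) Y i))
    (N : ModuleCat.{u} A) [Module.Finite A N] : Subsingleton (Ext N Y i) := by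
  suffices H : ∀ (N : Type u) [AddCommGroup N] [Module A N] (_ : Module.Finite A N),
      Subsingleton (Ext (ModuleCat.of A N) Y i) from H N inferInstance
  intro N _ _ hN
  induction hN using IsNoetherianRing.induction_on_isQuotientEquivQuotientPrime A with
  | subsingleton N =>
    have := (ModuleCat.isZero_of_subsingleton (ModuleCat.of A N)).hasProjectiveDimensionLT_zero
    exact HasProjectiveDimensionLT.subsingleton _ 0 i (Nat.zero_le i) Y
  | quotient N p e =>
    have := h p.1 p.2
    exact subsingleton_ext_of_iso e.toModuleIso Y i
  | exact N₁ N₂ N₃ f g hf hg hfg h₁ h₃ =>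
    exact subsingleton_ext_X₂_of_shortExact (IsShortExact.shortExact ⟨hf, hfg, hg⟩) h₁ h₃

variable [IsLocalRing A] [IsNoetherianRing A]

theorem subsingleton_ext_of_quotSMulTop {M Y : ModuleCat.{u} A} [Module.Finite A M]
    [Module.Finite A Y] {x : A} (hx : x ∈ maximalIdeal A) (reg : IsSMulRegular M x) (i : ℕ)
    (h : Subsingleton (Ext (ModuleCat.of A (QuotSMulTop x M)) Y (i + 1))) :
    Subsingleton (Ext M Y i) := by
  have surjective_smul : Function.Surjective ((Ext.mk₀ (x • 𝟙 M)).precomp Y (zero_add i)) :=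
    surjective_precomp_of_shortExact reg.smulShortComplex_shortExact h
  have top_le_smul_top : (⊤ : Submodule A (Ext M Y i)) ≤ x • ⊤ := by
    intro y _
    obtain ⟨z, rfl⟩ := surjective_smul y
    have precomp_eq_smul : (Ext.mk₀ (x • 𝟙 M)).precomp Y (zero_add i) z = x • z := by
      simp [Ext.mk₀_smul]
    exact precomp_eq_smul ▸ Submodule.smul_mem_pointwise_smul z x ⊤ trivial
  by_contra hnontrivial
  rw [not_subsingleton_iff_nontrivial] at hnontrivial
  exact Submodule.top_ne_pointwise_smul_of_mem_jacobson_annihilator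
    (IsLocalRing.maximalIdeal_le_jacobson _ hx) (top_le_iff.1 top_le_smul_top).symm

theorem subsingleton_ext_quotient_prime {Y : ModuleCat.{u} A} [Module.Finite A Y] {i : ℕ}
    (h : ∀ N : ModuleCat.{u} A, Module.Finite A N → Subsingleton (Ext N Y (i + 1)))
    {p : Ideal A} [p.IsPrime] (hp : p ≠ maximalIdeal A) :
    Subsingleton (Ext (ModuleCat.of A (A ⧸ p)) Y i) := by
  obtain ⟨x, hxm, hxp⟩ := SetLike.exists_of_lt ((le_maximalIdeal ‹p.IsPrime›.ne_top).lt_of_ne hp)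
  exact subsingleton_ext_of_quotSMulTop hxm (isSMulRegular_quotient_of_notMem hxp) i
    (h _ (by dsimp; infer_instance))

theorem subsingleton_ext_residueField {rs : List A} (hrs : IsRegular A rs)
    (hass : IsAssociatedPrime (maximalIdeal A) (A ⧸ Ideal.ofList rs)) {Y : ModuleCat.{u} A} {i : ℕ}
    (hi : rs.length < i)
    (h : ∀ N : ModuleCat.{u} A, Module.Finite A N → Subsingleton (Ext N Y (i + 1))) :
    Subsingleton (Ext (ModuleCat.of A (A ⧸ maximalIdeal A)) Y i) := by
  have hpd : HasProjectiveDimensionLT (ModuleCat.of A (A ⧸ Ideal.ofList rs)) i := by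
    rw [← projectiveDimension_lt_iff, ← projectiveDimension_eq_of_iso
      (Shrink.linearEquiv A (A ⧸ Ideal.ofList rs)).toModuleIso,
      ModuleCat.projectiveDimension_quotient_eq_length rs hrs]
    exact_mod_cast hi
  obtain ⟨-, ι, hι⟩ := (isAssociatedPrime_iff_exists_injective_linearMap _ _).1 hass
  exact subsingleton_ext_X₁_of_shortExact (isShortExact_mkQ_range hι).shortExact
    (HasProjectiveDimensionLT.subsingleton _ i i le_rfl Y) (h _ (by dsimp; infer_instance))

theorem subsingleton_ext_of_length_lt {rs : List A} (hrs : IsRegular A rs)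
    (hass : IsAssociatedPrime (maximalIdeal A) (A ⧸ Ideal.ofList rs)) {Y : ModuleCat.{u} A}
    [Module.Finite A Y] (hY : injectiveDimension Y ≠ ⊤) {i : ℕ} (hi : rs.length < i)
    (N : ModuleCat.{u} A) [Module.Finite A N] : Subsingleton (Ext N Y i) := by
  obtain ⟨n, hn⟩ := (injectiveDimension_ne_top_iff _).1 hY
  induction hk : n + 1 - i generalizing i N with
  | zero => exact HasInjectiveDimensionLT.subsingleton _ (n + 1) i (by omega) N
  | succ k ih =>
    have ih' : ∀ N : ModuleCat.{u} A, Module.Finite A N → Subsingleton (Ext N Y (i + 1)) :=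
      fun N _ => ih (by omega) N (by omega)
    refine subsingleton_ext_of_forall_quotient_prime (fun p hp => ?_) N
    rcases eq_or_ne p (maximalIdeal A) with rfl | hpm
    · exact subsingleton_ext_residueField hrs hass hi ih'
    · exact subsingleton_ext_quotient_prime ih' hpm

end Bass

section RegularSequence

variable {A : Type*} [CommRing A] [IsLocalRing A] {M : Type*} [AddCommGroup M] [Module A M]

theorem mem_maximalIdeal_of_isRegular {rs : List A} (h : IsRegular M rs) :
    ∀ r ∈ rs, r ∈ maximalIdeal A := by
  intro r hr
  have ofList_ne_top : Ideal.ofList rs ≠ ⊤ := fun htop =>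
    h.top_ne_smul (by rw [htop, Submodule.top_smul])
  exact le_maximalIdeal ofList_ne_top (Ideal.subset_span hr)

variable [IsNoetherianRing A] [Module.Finite A M]

theorem length_le_ringKrullDim_of_isRegular {rs : List A} (h : IsRegular M rs) :
    (rs.length : WithBot ℕ∞) ≤ ringKrullDim A := by
  have hntr : Nontrivial (M ⧸ (Ideal.ofList rs • ⊤ : Submodule A M)) :=
    Submodule.Quotient.nontrivial_iff.2 h.top_ne_smul.symm
  have hdim : 0 ≤ supportDim A (M ⧸ (Ideal.ofList rs • ⊤ : Submodule A M)) :=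
    Order.krullDim_nonneg_iff.2 (Module.nonempty_support_of_nontrivial.to_subtype)
  calc (rs.length : WithBot ℕ∞)
      ≤ supportDim A (M ⧸ (Ideal.ofList rs • ⊤ : Submodule A M)) + rs.length :=
        le_add_of_nonneg_left hdim
    _ = supportDim A M := supportDim_add_length_eq_supportDim_of_isRegular rs h
    _ ≤ ringKrullDim A := supportDim_le_ringKrullDim A M

theorem isAssociatedPrime_maximalIdeal_of_forall_not_isSMulRegular
    (h : ∀ r ∈ maximalIdeal A, ¬ IsSMulRegular M r) : IsAssociatedPrime (maximalIdeal A) M := by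
  have hntr : Nontrivial ((A ⧸ maximalIdeal A) →ₗ[A] M) := by
    rw [← not_subsingleton_iff_nontrivial, IsSMulRegular.subsingleton_linearMap_iff]
    rintro ⟨r, hr, hreg⟩
    exact h r (by rwa [Ideal.annihilator_quotient] at hr) hreg
  obtain ⟨φ, hφ⟩ := exists_ne (0 : (A ⧸ maximalIdeal A) →ₗ[A] M)
  have := isSimpleModule_iff_isCoatom.2 (maximalIdeal.isMaximal A).out
  exact (isAssociatedPrime_iff_exists_injective_linearMap _ _).2
    ⟨inferInstance, φ, (LinearMap.injective_or_eq_zero φ).resolve_right hφ⟩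

theorem isAssociatedPrime_maximalIdeal_of_forall_length_le {rs : List A} (h : IsRegular M rs)
    (hmax : ∀ qs : List A, IsRegular M qs → qs.length ≤ rs.length) :
    IsAssociatedPrime (maximalIdeal A) (M ⧸ (Ideal.ofList rs • ⊤ : Submodule A M)) := by
  refine isAssociatedPrime_maximalIdeal_of_forall_not_isSMulRegular fun r hr hreg => ?_
  have := h.nontrivial
  have isRegular_append : IsRegular M (rs ++ [r]) :=
    .of_isWeaklyRegular_of_mem_maximalIdeal M
      (List.forall_mem_append.2 ⟨mem_maximalIdeal_of_isRegular h, by simpa using hr⟩)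
      ((isWeaklyRegular_append_iff M rs [r]).2 ⟨h.1, (isWeaklyRegular_singleton_iff _ r).2 hreg⟩)
  simpa using hmax _ isRegular_append

variable (A M) in
theorem exists_isRegular_forall_length_le [Nontrivial M] :
    ∃ rs : List A, IsRegular M rs ∧ ∀ qs : List A, IsRegular M qs → qs.length ≤ rs.length := by
  let lengths : Set ℕ := {n | ∃ rs : List A, IsRegular M rs ∧ rs.length = n}
  obtain ⟨d, hd⟩ : ∃ d : ℕ, (d : WithBot ℕ∞) = ringKrullDim A :=
    ⟨(maximalIdeal A).height.toNat, by
      rw [← maximalIdeal_height_eq_ringKrullDim, ← ENat.natCast_toNat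
        (Ideal.height_ne_top (maximalIdeal.isMaximal A).ne_top)]
      rfl⟩
  have hbdd : BddAbove lengths := by
    refine ⟨d, ?_⟩
    rintro _ ⟨rs, hrs, rfl⟩
    exact_mod_cast (length_le_ringKrullDim_of_isRegular hrs).trans_eq hd.symm
  obtain ⟨rs, hrs, hlength⟩ := Nat.sSup_mem (s := lengths) ⟨0, [], IsRegular.nil A M, rfl⟩ hbdd
  exact ⟨rs, hrs, fun qs hqs => hlength ▸ le_csSup hbdd ⟨qs, hqs, rfl⟩⟩

end RegularSequence

section SelfInjective

variable {R : Type u} [CommRing R] [IsLocalRing R] [IsNoetherianRing R] {E : Type u}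
  [AddCommGroup E] [Module R E]

theorem exists_linearMap_apply_ne_zero (hE : Module.Injective R E)
    (hass : IsAssociatedPrime (maximalIdeal R) E) {N : Type*} [AddCommGroup N] [Module R N]
    {z : N} (hz : z ≠ 0) : ∃ ψ : N →ₗ[R] E, ψ z ≠ 0 := by
  obtain ⟨-, ι, hι⟩ := (isAssociatedPrime_iff_exists_injective_linearMap _ _).1 hass
  have ker_le : LinearMap.ker (LinearMap.toSpanSingleton R N z) ≤ maximalIdeal R :=
    le_maximalIdeal fun htop =>
      hz (by simpa using LinearMap.congr_fun (LinearMap.ker_eq_top.1 htop) 1)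
  obtain ⟨ψ, hψ⟩ := (Module.Baer.of_injective hE).extension_property
    (Submodule.liftQ _ (LinearMap.toSpanSingleton R N z) le_rfl)
    (LinearMap.ker_eq_bot.1 (Submodule.ker_liftQ_eq_bot _ _ _ le_rfl))
    (ι ∘ₗ Submodule.mapQ _ _ LinearMap.id ker_le)
  refine ⟨ψ, ?_⟩
  have apply_eq : ψ z = ι 1 := by
    have h := LinearMap.congr_fun hψ (Submodule.Quotient.mk 1)
    rwa [LinearMap.comp_apply, Submodule.liftQ_apply, LinearMap.toSpanSingleton_apply_one] at h
  rw [apply_eq, Ne, map_eq_zero_iff ι hι]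
  exact one_ne_zero

/- For a nonmaximal prime `p` and `x ∈ 𝔪 \ p`, injectivity makes `x` act surjectively on
`Hom(R/p, E)`, which then vanishes by Nakayama's lemma. -/
theorem krullDimLE_zero_of_injective [Module.Finite R E] (hE : Module.Injective R E)
    (hass : IsAssociatedPrime (maximalIdeal R) E) : Ring.KrullDimLE 0 R := by
  refine Ring.krullDimLE_zero_iff.2 fun p hp => ?_
  suffices hpm : p = maximalIdeal R from hpm ▸ maximalIdeal.isMaximal R
  by_contra hpm
  obtain ⟨x, hxm, hxp⟩ := SetLike.exists_of_lt ((le_maximalIdeal hp.ne_top).lt_of_ne hpm)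
  have top_le_smul_top : (⊤ : Submodule R ((R ⧸ p) →ₗ[R] E)) ≤ maximalIdeal R • ⊤ := by
    intro φ _
    obtain ⟨ψ, hψ⟩ := (Module.Baer.of_injective hE).extension_property
      (LinearMap.lsmul R (R ⧸ p) x) (isSMulRegular_quotient_of_notMem hxp) φ
    have hφ : φ = x • ψ := by rw [← hψ]; ext; simp
    exact hφ ▸ Submodule.smul_mem_smul hxm trivial
  have hzero : (⊤ : Submodule R ((R ⧸ p) →ₗ[R] E)) = ⊥ :=
    Submodule.eq_bot_of_le_smul_of_le_jacobson_bot (maximalIdeal R) _ (IsNoetherian.noetherian _)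
      top_le_smul_top (maximalIdeal_le_jacobson _)
  obtain ⟨ψ, hψ⟩ := exists_linearMap_apply_ne_zero hE hass (one_ne_zero (α := R ⧸ p))
  exact hψ (LinearMap.congr_fun ((Submodule.mem_bot R).1 (hzero ▸ Submodule.mem_top : ψ ∈ _)) 1)

end SelfInjective

section Gorenstein

variable {A : Type u} [CommRing A]

theorem ext_comp_smul_id_eq_zero {N Y : ModuleCat.{u} A} {r : A} (hr : r ∈ annihilator A N)
    {i : ℕ} (w : Ext N Y i) : w.comp (Ext.mk₀ (r • 𝟙 Y)) (add_zero i) = 0 := by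
  simpa using ConcreteCategory.congr_hom
    (Ext.postcomp_smul_id_eq_zero_of_mem_annihilator (M := Y) hr i) w

theorem isLocalRing_quotient_ofList [IsLocalRing A] {rs : List A} (hrs : IsRegular A rs) :
    IsLocalRing (A ⧸ Ideal.ofList rs) := by
  have hntr : Nontrivial (A ⧸ Ideal.ofList rs) := Ideal.Quotient.nontrivial_iff.2 fun htop =>
    hrs.top_ne_smul (by rw [htop, Submodule.top_smul])
  exact IsLocalRing.of_surjective' _ Ideal.Quotient.mk_surjective

variable [IsNoetherianRing A]

theorem exists_extension_of_surjective_precomp_ext (rs : List A) (Y : ModuleCat.{u} A)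
    [Module.Finite A Y] (hrs : IsRegular Y rs) {N' N : ModuleCat.{u} A} [Module.Finite A N']
    (g : N' ⟶ N) (hN : Ideal.ofList rs ≤ annihilator A N)
    (hN' : Ideal.ofList rs ≤ annihilator A N')
    (hext : Function.Surjective ((Ext.mk₀ g).precomp Y (zero_add rs.length)))
    (φ : N' →ₗ[A] Y ⧸ (Ideal.ofList rs • ⊤ : Submodule A Y)) :
    ∃ ψ : N →ₗ[A] Y ⧸ (Ideal.ofList rs • ⊤ : Submodule A Y), ψ ∘ₗ g.hom = φ := by
  induction rs generalizing Y with
  | nil =>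
    let e := Submodule.quotEquivOfEqBot (Ideal.ofList ([] : List A) • ⊤ : Submodule A Y) (by simp)
    obtain ⟨ψ, hψ⟩ := exists_comp_eq_of_surjective_precomp hext
      (ModuleCat.ofHom (e.toLinearMap ∘ₗ φ))
    refine ⟨e.symm.toLinearMap ∘ₗ ψ.hom, ?_⟩
    rw [LinearMap.comp_assoc, ← ModuleCat.hom_comp, hψ, ModuleCat.hom_ofHom,
      LinearEquiv.symm_comp_cancel_left]
  | cons r rs ih =>
    have hvan : Subsingleton (Ext N' Y rs.length) := by
      refine ModuleCat.subsingleton_ext_of_exists_isRegular (Ideal.ofList (r :: rs)) N' ?_ Y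
        hrs.2.symm.lt_top (r :: rs) (fun x hx => Ideal.subset_span hx) hrs _ (by simp)
      rw [Module.support_eq_zeroLocus]
      exact PrimeSpectrum.zeroLocus_anti_mono_ideal hN'
    have hr : r ∈ Ideal.ofList (r :: rs) := Ideal.subset_span (by simp)
    have hle : Ideal.ofList rs ≤ Ideal.ofList (r :: rs) := by simp
    obtain ⟨hr_regular, hrs'⟩ := (isRegular_cons_iff _ _ _).1 hrs
    let e := Submodule.quotOfListConsSMulTopEquivQuotSMulTopInner Y r rs
    obtain ⟨ψ, hψ⟩ := ih (ModuleCat.of A (QuotSMulTop r Y)) hrs' (hle.trans hN) (hle.trans hN')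
      (surjective_precomp_X₃_of_shortExact hr_regular.smulShortComplex_shortExact g
        (ext_comp_smul_id_eq_zero (hN hr)) hvan hext) (e.toLinearMap ∘ₗ φ)
    refine ⟨e.symm.toLinearMap ∘ₗ ψ, ?_⟩
    rw [LinearMap.comp_assoc, hψ, LinearEquiv.symm_comp_cancel_left]

variable [IsLocalRing A] {rs : List A}

theorem exists_extension_quotient_ofList (hA : IsGorenstein A) (hrs : IsRegular A rs)
    (hass : IsAssociatedPrime (maximalIdeal A) (A ⧸ Ideal.ofList rs))
    {N' N : Type u} [AddCommGroup N'] [Module A N'] [AddCommGroup N]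
    [Module A N] [Module.Finite A N] (hN : Ideal.ofList rs ≤ annihilator A N)
    {g : N' →ₗ[A] N} (hg : Function.Injective g) (φ : N' →ₗ[A] A ⧸ Ideal.ofList rs) :
    ∃ ψ : N →ₗ[A] A ⧸ Ideal.ofList rs, ψ ∘ₗ g = φ := by
  have : Module.Finite A N' := Module.Finite.of_injective g hg
  let e := Submodule.quotEquivOfEq (Ideal.ofList rs • ⊤ : Submodule A A) (Ideal.ofList rs)
    (by rw [smul_eq_mul, Ideal.mul_top])
  have ext_range_mkQ_subsingleton :=
    subsingleton_ext_of_length_lt hrs hass hA (Nat.lt_succ_self rs.length)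
      (ModuleCat.of A (N ⧸ LinearMap.range g))
  obtain ⟨ψ, hψ⟩ := exists_extension_of_surjective_precomp_ext rs (ModuleCat.of A A) hrs
    (ModuleCat.ofHom g) hN (hN.trans (LinearMap.annihilator_le_of_injective g hg))
    (surjective_precomp_of_shortExact (isShortExact_mkQ_range hg).shortExact
      ext_range_mkQ_subsingleton) (e.symm.toLinearMap ∘ₗ φ)
  refine ⟨e.toLinearMap ∘ₗ ψ, ?_⟩
  rw [LinearMap.comp_assoc, ← ModuleCat.hom_ofHom g, hψ, LinearEquiv.comp_symm_cancel_left]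

theorem injective_quotient_ofList (hA : IsGorenstein A) (hrs : IsRegular A rs)
    (hass : IsAssociatedPrime (maximalIdeal A) (A ⧸ Ideal.ofList rs)) :
    Module.Injective (A ⧸ Ideal.ofList rs) (A ⧸ Ideal.ofList rs) := by
  refine Module.Baer.injective fun J φ => ?_
  obtain ⟨ψ, hψ⟩ := exists_extension_quotient_ofList hA hrs hass
    (N := A ⧸ Ideal.ofList rs) Ideal.annihilator_quotient.ge
    (g := J.subtype.restrictScalars A) Subtype.val_injective (φ.restrictScalars A)
  exact ⟨ψ.extendScalarsOfSurjective Ideal.Quotient.mk_surjective,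
    fun x hx => LinearMap.congr_fun hψ ⟨x, hx⟩⟩

theorem isAssociatedPrime_maximalIdeal_quotient {I : Ideal A} [IsLocalRing (A ⧸ I)]
    (h : IsAssociatedPrime (maximalIdeal A) (A ⧸ I)) :
    IsAssociatedPrime (maximalIdeal (A ⧸ I)) (A ⧸ I) := by
  refine isAssociatedPrime_maximalIdeal_of_forall_not_isSMulRegular fun r hr hreg => ?_
  obtain ⟨-, s, hs⟩ := isAssociatedPrime_iff.1 h
  obtain ⟨x, rfl⟩ := Ideal.Quotient.mk_surjective r
  have hx : x ∈ maximalIdeal A := fun hu => hr (hu.map _)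
  have smul_eq_zero : x • s = 0 :=
    (Submodule.mem_bot A).1 (Submodule.mem_colon_singleton.1 (hs ▸ hx))
  have hs0 : s = 0 := hreg (by simpa [Algebra.smul_def] using smul_eq_zero)
  exact h.isPrime.ne_top (hs.trans (by simp [hs0]))

theorem length_eq_ringKrullDim_of_isGorenstein (hA : IsGorenstein A) (hrs : IsRegular A rs)
    (hass : IsAssociatedPrime (maximalIdeal A) (A ⧸ Ideal.ofList rs)) :
    (rs.length : WithBot ℕ∞) = ringKrullDim A := by
  have := isLocalRing_quotient_ofList hrs
  have := krullDimLE_zero_of_injective (injective_quotient_ofList hA hrs hass)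
    (isAssociatedPrime_maximalIdeal_quotient hass)
  rw [← ringKrullDim_add_length_eq_ringKrullDim_of_isRegular rs hrs,
    ringKrullDimZero_iff_ringKrullDim_eq_zero.1 this, zero_add]

theorem exists_linearMap_quotient_apply_ne_zero (hA : IsGorenstein A) (hrs : IsRegular A rs)
    (hass : IsAssociatedPrime (maximalIdeal A) (A ⧸ Ideal.ofList rs))
    {N : Type*} [AddCommGroup N] [Module A N] {z : N ⧸ (Ideal.ofList rs • ⊤ : Submodule A N)}
    (hz : z ≠ 0) :
    ∃ ψ : (N ⧸ (Ideal.ofList rs • ⊤ : Submodule A N)) →ₗ[A] A ⧸ Ideal.ofList rs, ψ z ≠ 0 := by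
  have := isLocalRing_quotient_ofList hrs
  obtain ⟨ψ, hψ⟩ := exists_linearMap_apply_ne_zero (injective_quotient_ofList hA hrs hass)
    (isAssociatedPrime_maximalIdeal_quotient hass) hz
  exact ⟨ψ.restrictScalars A, hψ⟩

end Gorenstein

section WeaklyRegular

variable {A : Type*} [CommRing A]

theorem isWeaklyRegular_of_leftInverse {rs : List A} {M N : Type*} [AddCommGroup M] [Module A M]
    [AddCommGroup N] [Module A N] {i : M →ₗ[A] N} {p : N →ₗ[A] M} (h : p ∘ₗ i = LinearMap.id)
    (hN : IsWeaklyRegular N rs) : IsWeaklyRegular M rs := by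
  induction rs generalizing M N with
  | nil => exact IsWeaklyRegular.nil _ _
  | cons r rs ih =>
    rw [isWeaklyRegular_cons_iff] at hN ⊢
    refine ⟨hN.1.of_injective i (Function.LeftInverse.injective (LinearMap.congr_fun h)),
      ih (i := QuotSMulTop.map r i) (p := QuotSMulTop.map r p) ?_ hN.2⟩
    rw [← QuotSMulTop.map_comp, h, QuotSMulTop.map_id]

theorem comap_mkQ_ofList_smul_top {M : Type*} [AddCommGroup M] [Module A M] (r : A)
    (rs : List A) :
    (Ideal.ofList rs • ⊤ : Submodule A (QuotSMulTop r M)).comap (Submodule.mkQ _) =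
      Ideal.ofList (r :: rs) • ⊤ := by
  rw [Submodule.comap_smul_top_of_surjective _ _ (Submodule.mkQ_surjective _), Submodule.ker_mkQ,
    Ideal.ofList_cons_smul, sup_comm]

variable {M Q C : Type*} [AddCommGroup M] [Module A M] [AddCommGroup Q] [Module A Q]
  [AddCommGroup C] [Module A C] {f : M →ₗ[A] Q} {g : Q →ₗ[A] C} {r : A}

theorem exists_eq_smul_of_injective_quotSMulTop_map (hQ : IsSMulRegular Q r)
    (hf : Function.Injective (QuotSMulTop.map r f)) {m : M} {q : Q} (h : f m = r • q) :
    ∃ m', m = r • m' ∧ f m' = q := by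
  have mk_eq_zero : (Submodule.Quotient.mk m : QuotSMulTop r M) = 0 := by
    refine (map_eq_zero_iff _ hf).1 ((Submodule.Quotient.mk_eq_zero _).2 ?_)
    exact h ▸ Submodule.smul_mem_pointwise_smul q r ⊤ trivial
  obtain ⟨m', -, rfl⟩ := (Submodule.mem_smul_pointwise_iff_exists _ _ _).1
    ((Submodule.Quotient.mk_eq_zero _).1 mk_eq_zero)
  exact ⟨m', rfl, hQ ((f.map_smul r m').symm.trans h)⟩

theorem injective_of_injective_quotSMulTop_map [IsLocalRing A] [IsNoetherian A M]
    (hr : r ∈ maximalIdeal A) (hQ : IsSMulRegular Q r)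
    (hf : Function.Injective (QuotSMulTop.map r f)) : Function.Injective f := by
  refine LinearMap.ker_eq_bot.1 (Submodule.eq_bot_of_le_smul_of_le_jacobson_bot (maximalIdeal A) _
    (IsNoetherian.noetherian _) (fun m hm => ?_) (maximalIdeal_le_jacobson _))
  obtain ⟨m', rfl, hm'⟩ := exists_eq_smul_of_injective_quotSMulTop_map (q := 0) hQ hf
    ((LinearMap.mem_ker.1 hm).trans (smul_zero r).symm)
  exact Submodule.smul_mem_smul hr hm'

theorem isSMulRegular_of_injective_quotSMulTop_map (hQ : IsSMulRegular Q r)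
    (hf : Function.Injective (QuotSMulTop.map r f)) (hfg : Function.Exact f g)
    (hg : Function.Surjective g) : IsSMulRegular C r := by
  refine isSMulRegular_iff_right_eq_zero_of_smul.2 fun c hc => ?_
  obtain ⟨q, rfl⟩ := hg c
  obtain ⟨m, hm⟩ := (hfg (r • q)).1 (by rw [map_smul, hc])
  obtain ⟨m', -, rfl⟩ := exists_eq_smul_of_injective_quotSMulTop_map hQ hf hm
  exact hfg.apply_apply_eq_zero m'

theorem injective_and_isWeaklyRegular_of_comap_le [IsLocalRing A] {rs : List A}
    (hmem : ∀ r ∈ rs, r ∈ maximalIdeal A) [IsNoetherian A M] (hQ : IsWeaklyRegular Q rs)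
    (hfg : Function.Exact f g) (hg : Function.Surjective g)
    (hf : (Ideal.ofList rs • ⊤ : Submodule A Q).comap f ≤ Ideal.ofList rs • ⊤) :
    Function.Injective f ∧ IsWeaklyRegular C rs := by
  induction rs generalizing M Q C with
  | nil => exact ⟨LinearMap.ker_eq_bot.1 (by simpa using hf), IsWeaklyRegular.nil _ _⟩
  | cons r rs ih =>
    obtain ⟨hr, hmem⟩ := List.forall_mem_cons.1 hmem
    rw [isWeaklyRegular_cons_iff] at hQ ⊢
    have comap_map_le : (Ideal.ofList rs • ⊤ : Submodule A (QuotSMulTop r Q)).comap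
        (QuotSMulTop.map r f) ≤ Ideal.ofList rs • ⊤ := by
      rw [← Submodule.comap_le_comap_iff_of_surjective (Submodule.mkQ_surjective _),
        ← Submodule.comap_comp, comap_mkQ_ofList_smul_top]
      rw [← comap_mkQ_ofList_smul_top] at hf
      exact hf
    obtain ⟨map_injective, hC⟩ := ih hmem hQ.2 (QuotSMulTop.map_exact r hfg hg)
      (QuotSMulTop.map_surjective r hg) comap_map_le
    exact ⟨injective_of_injective_quotSMulTop_map hr hQ.1 map_injective,
      isSMulRegular_of_injective_quotSMulTop_map hQ.1 map_injective hfg hg, hC⟩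

end WeaklyRegular

section MaximalCohenMacaulay

variable {A : Type u} [CommRing A]

theorem exists_lift_of_isWeaklyRegular {rs : List A} {Y M : ModuleCat.{u} A}
    (hrs : IsWeaklyRegular Y rs) (h : ∀ i, 0 < i → Subsingleton (Ext M Y i))
    (φ : M →ₗ[A] Y ⧸ (Ideal.ofList rs • ⊤ : Submodule A Y)) :
    ∃ ψ : M →ₗ[A] Y, Submodule.mkQ _ ∘ₗ ψ = φ := by
  induction rs generalizing Y with
  | nil =>
    let e := Submodule.quotEquivOfEqBot (Ideal.ofList ([] : List A) • ⊤ : Submodule A Y) (by simp)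
    exact ⟨e.toLinearMap ∘ₗ φ, LinearMap.ext fun x => e.injective (by simp [e])⟩
  | cons r rs ih =>
    obtain ⟨hr, hrs⟩ := (isWeaklyRegular_cons_iff _ _ _).1 hrs
    let e := Submodule.quotOfListConsSMulTopEquivQuotSMulTopInner Y r rs
    have hS := hr.smulShortComplex_shortExact
    obtain ⟨ψ, hψ⟩ := ih (Y := ModuleCat.of A (QuotSMulTop r Y)) hrs
      (fun i hi => subsingleton_ext_X₃_of_shortExact hS (h i hi) (h (i + 1) i.succ_pos))
      (e.toLinearMap ∘ₗ φ)
    obtain ⟨χ, hχ⟩ : ∃ χ : M ⟶ Y, χ ≫ (ModuleCat.smulShortComplex Y r).g = ModuleCat.ofHom ψ :=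
      exists_comp_eq_of_surjective_postcomp (surjective_postcomp_of_shortExact hS (h 1 one_pos)) _
    have mkQ_comp_eq : Submodule.mkQ _ ∘ₗ χ.hom = ψ := congrArg ModuleCat.Hom.hom hχ
    refine ⟨χ.hom, LinearMap.ext fun x => e.injective ?_⟩
    exact (congrArg (Submodule.mkQ _) (LinearMap.congr_fun mkQ_comp_eq x)).trans
      (LinearMap.congr_fun hψ x)

theorem isMCM_of_equiv [IsLocalRing A] {M N : Type u} [AddCommGroup M] [Module A M]
    [AddCommGroup N] [Module A N] (e : M ≃ₗ[A] N) (h : isMCM A (ModuleCat.of A M)) :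
    isMCM A (ModuleCat.of A N) := by
  obtain ⟨hfin, hsub | ⟨rs, hlength, hmem, hrs⟩⟩ := h
  · exact ⟨.equiv e, Or.inl (e.symm.toEquiv.subsingleton_congr.2 hsub)⟩
  · exact ⟨.equiv e, Or.inr ⟨rs, hlength, hmem, (e.isRegular_congr rs).1 hrs⟩⟩

theorem exists_comp_cosyzygyIn_eq [IsNoetherianRing A] {M : Type u} [AddCommGroup M] [Module A M]
    [Module.Finite A M] (φ : Dual A M) :
    ∃ b : (Fin (dualRank A M) → A) →ₗ[A] A, b ∘ₗ cosyzygyIn A M = φ := by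
  obtain ⟨b, hb⟩ := exists_extend (LinearMap.pi fun _ : Fin 1 => φ)
  exact ⟨LinearMap.proj 0 ∘ₗ b, by rw [LinearMap.comp_assoc, hb, LinearMap.proj_pi]⟩

variable [IsLocalRing A] [IsNoetherianRing A]

theorem subsingleton_ext_of_isWeaklyRegular {Y : ModuleCat.{u} A} [Module.Finite A Y]
    {rs : List A} (hmem : ∀ r ∈ rs, r ∈ maximalIdeal A) (M : ModuleCat.{u} A) [Module.Finite A M]
    (hrs : IsWeaklyRegular M rs) (i : ℕ)
    (h : ∀ N : ModuleCat.{u} A, Module.Finite A N → Subsingleton (Ext N Y (i + rs.length))) :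
    Subsingleton (Ext M Y i) := by
  induction rs generalizing M i with
  | nil => exact h M inferInstance
  | cons r rs ih =>
    obtain ⟨hr, hmem⟩ := List.forall_mem_cons.1 hmem
    obtain ⟨hr_regular, hrs⟩ := (isWeaklyRegular_cons_iff _ _ _).1 hrs
    have : Module.Finite A (ModuleCat.of A (QuotSMulTop r M)) := by dsimp; infer_instance
    refine subsingleton_ext_of_quotSMulTop hr hr_regular i (ih hmem _ hrs (i + 1) ?_)
    rwa [add_assoc, add_comm 1, ← List.length_cons]

theorem isMCM_self (hA : IsGorenstein A) : isMCM A (ModuleCat.of A A) := by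
  obtain ⟨rs, hrs, hmax⟩ := exists_isRegular_forall_length_le A A
  have hass := isAssociatedPrime_maximalIdeal_of_forall_length_le hrs hmax
  rw [smul_eq_mul, Ideal.mul_top] at hass
  exact ⟨inferInstanceAs (Module.Finite A A), Or.inr ⟨rs,
    length_eq_ringKrullDim_of_isGorenstein hA hrs hass, mem_maximalIdeal_of_isRegular hrs, hrs⟩⟩

theorem isMCM_pi (hA : IsGorenstein A) (n : ℕ) : isMCM A (ModuleCat.of A (Fin n → A)) := by
  induction n with
  | zero => exact ⟨inferInstanceAs (Module.Finite A (Fin 0 → A)),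
      Or.inl (inferInstanceAs (Subsingleton (Fin 0 → A)))⟩
  | succ n ih =>
    exact isMCM_of_equiv (Fin.consLinearEquiv A fun _ => A) (isMCM_prod _ _ (isMCM_self hA) ih)

theorem isMCM_of_free (hA : IsGorenstein A) (F : Type u) [AddCommGroup F] [Module A F]
    [Module.Finite A F] [Module.Free A F] : isMCM A (ModuleCat.of A F) :=
  isMCM_of_equiv (Module.finBasis A F).equivFun.symm (isMCM_pi hA _)

theorem isAssociatedPrime_maximalIdeal_of_length_eq {rs : List A} (hrs : IsRegular A rs)
    (hlength : (rs.length : WithBot ℕ∞) = ringKrullDim A) :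
    IsAssociatedPrime (maximalIdeal A) (A ⧸ Ideal.ofList rs) := by
  have hass := isAssociatedPrime_maximalIdeal_of_forall_length_le hrs fun qs hqs =>
    by exact_mod_cast (length_le_ringKrullDim_of_isRegular hqs).trans_eq hlength.symm
  rwa [smul_eq_mul, Ideal.mul_top] at hass

variable {M : Type u} [AddCommGroup M] [Module A M]

theorem exists_isRegular_isWeaklyRegular_of_isMCM (hA : IsGorenstein A)
    (hM : isMCM A (ModuleCat.of A M)) : ∃ rs : List A, (rs.length : WithBot ℕ∞) = ringKrullDim A ∧
      IsRegular A rs ∧ IsWeaklyRegular M rs := by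
  obtain ⟨-, hsub | ⟨rs, hlength, hmem, hrs⟩⟩ := isMCM_prod _ _ (isMCM_self hA) hM
  · exact absurd (hsub.elim ((1 : A), (0 : M)) ((0 : A), (0 : M))) (by simp)
  · exact ⟨rs, hlength,
      .of_isWeaklyRegular_of_mem_maximalIdeal A hmem
        (isWeaklyRegular_of_leftInverse (LinearMap.fst_comp_inl A A M) hrs.1),
      isWeaklyRegular_of_leftInverse (LinearMap.snd_comp_inr A A M) hrs.1⟩

theorem subsingleton_ext_self_of_isMCM (hA : IsGorenstein A) (hM : isMCM A (ModuleCat.of A M))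
    {i : ℕ} (hi : 0 < i) : Subsingleton (Ext (ModuleCat.of A M) (ModuleCat.of A A) i) := by
  obtain ⟨rs, hlength, hrs, hrsM⟩ := exists_isRegular_isWeaklyRegular_of_isMCM hA hM
  have := hM.1
  exact subsingleton_ext_of_isWeaklyRegular (mem_maximalIdeal_of_isRegular hrs) _ hrsM i
    fun N _ => subsingleton_ext_of_length_lt hrs
      (isAssociatedPrime_maximalIdeal_of_length_eq hrs hlength) hA (by omega) N

variable [Module.Finite A M]

theorem comap_cosyzygyIn_smul_top_le (hA : IsGorenstein A) (hM : isMCM A (ModuleCat.of A M))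
    {rs : List A} (hlength : (rs.length : WithBot ℕ∞) = ringKrullDim A) (hrs : IsRegular A rs) :
    (Ideal.ofList rs • ⊤ : Submodule A (Fin (dualRank A M) → A)).comap (cosyzygyIn A M) ≤
      Ideal.ofList rs • ⊤ := by
  intro m hm
  by_contra hm'
  obtain ⟨ψ, hψ⟩ := exists_linearMap_quotient_apply_ne_zero hA hrs
    (isAssociatedPrime_maximalIdeal_of_length_eq hrs hlength)
    (mt (Submodule.Quotient.mk_eq_zero _).1 hm')
  let e := Submodule.quotEquivOfEq (Ideal.ofList rs • ⊤ : Submodule A A) (Ideal.ofList rs)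
    (by rw [smul_eq_mul, Ideal.mul_top])
  obtain ⟨φ, hφ⟩ := exists_lift_of_isWeaklyRegular (Y := ModuleCat.of A A)
    (M := ModuleCat.of A M) hrs.1 (fun i => subsingleton_ext_self_of_isMCM hA hM)
    (e.symm.toLinearMap ∘ₗ ψ ∘ₗ Submodule.mkQ _)
  obtain ⟨b, rfl⟩ := exists_comp_cosyzygyIn_eq φ
  have apply_mem : b (cosyzygyIn A M m) ∈ (Ideal.ofList rs • ⊤ : Submodule A A) :=
    Submodule.smul_top_le_comap_smul_top _ b hm
  have symm_apply_eq_zero : e.symm (ψ (Submodule.Quotient.mk m)) = 0 :=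
    (LinearMap.congr_fun hφ m).symm.trans ((Submodule.Quotient.mk_eq_zero _).2 apply_mem)
  exact hψ ((map_eq_zero_iff _ e.symm.injective).1 symm_apply_eq_zero)

theorem cosyzygyIn_injective_and_isMCM (hA : IsGorenstein A) (hM : isMCM A (ModuleCat.of A M)) :
    Function.Injective (cosyzygyIn A M) ∧ isMCM A (ModuleCat.of A (Cosyzygy A M)) := by
  obtain ⟨rs, hlength, hrs, -⟩ := exists_isRegular_isWeaklyRegular_of_isMCM hA hM
  have hmem := mem_maximalIdeal_of_isRegular hrs
  have isWeaklyRegular_pi : IsWeaklyRegular (Fin (dualRank A M) → A) rs :=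
    ((TensorProduct.rid A _).isWeaklyRegular_congr rs).1 hrs.1.isWeaklyRegular_lTensor
  obtain ⟨hinj, hreg⟩ := injective_and_isWeaklyRegular_of_comap_le hmem isWeaklyRegular_pi
    (LinearMap.exact_map_mkQ_range _) (Submodule.mkQ_surjective _)
    (comap_cosyzygyIn_smul_top_le hA hM hlength hrs)
  refine ⟨hinj, inferInstanceAs (Module.Finite A (Cosyzygy A M)), ?_⟩
  rcases subsingleton_or_nontrivial (Cosyzygy A M) with hsub | hntr
  · exact Or.inl hsub
  · exact Or.inr ⟨rs, hlength, hmem, .of_isWeaklyRegular_of_mem_maximalIdeal _ hmem hreg⟩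

theorem isShortExact_cosyzygy (hA : IsGorenstein A) (hM : isMCM A (ModuleCat.of A M)) :
    IsShortExact (cosyzygyIn A M) (cosyzygyOut A M) :=
  isShortExact_mkQ_range (cosyzygyIn_injective_and_isMCM hA hM).1

end MaximalCohenMacaulay

section StableEquivalence

variable {A : Type u} [CommRing A] {M N L : Type u} [AddCommGroup M] [Module A M]
  [AddCommGroup N] [Module A N] [AddCommGroup L] [Module A L]

theorem FactorsThroughFree.comp_left {f : M →ₗ[A] N} (hf : FactorsThroughFree f)
    (g : N →ₗ[A] L) : FactorsThroughFree (g ∘ₗ f) := by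
  obtain ⟨n, a, b, rfl⟩ := hf
  exact ⟨n, a, g ∘ₗ b, rfl⟩

theorem FactorsThroughFree.comp_right {g : N →ₗ[A] L} (hg : FactorsThroughFree g)
    (f : M →ₗ[A] N) : FactorsThroughFree (g ∘ₗ f) := by
  obtain ⟨n, a, b, rfl⟩ := hg
  exact ⟨n, a ∘ₗ f, b, rfl⟩

theorem factorsThroughFree_id_of_free [Module.Finite A M] [Module.Free A M] :
    FactorsThroughFree (LinearMap.id : M →ₗ[A] M) :=
  let e := ((Free.chooseBasis A M).reindex (Fintype.equivFin _)).equivFun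
  ⟨_, e.toLinearMap, e.symm.toLinearMap, e.symm_comp⟩

theorem factorsThroughFree_of_free_source [Module.Finite A M] [Module.Free A M]
    (f : M →ₗ[A] N) : FactorsThroughFree f :=
  factorsThroughFree_id_of_free.comp_left f

theorem factorsThroughFree_of_free_target [Module.Finite A N] [Module.Free A N]
    (f : M →ₗ[A] N) : FactorsThroughFree f :=
  factorsThroughFree_id_of_free.comp_right f

theorem free_of_factorsThroughFree_id [IsLocalRing A] [Module.Finite A M]
    (h : FactorsThroughFree (LinearMap.id : M →ₗ[A] M)) : Module.Free A M := by
  obtain ⟨n, a, b, hba⟩ := h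
  have : Module.Projective A M := Module.Projective.of_split a b hba
  have : Module.FinitePresentation A M := Module.finitePresentation_of_projective A M
  exact Module.free_of_flat_of_isLocalRing

theorem nonempty_equiv_ker_prod_of_rightInverse {s : M →ₗ[A] N} {r : N →ₗ[A] M}
    (h : r ∘ₗ s = LinearMap.id) : Nonempty (N ≃ₗ[A] LinearMap.ker r × M) :=
  ⟨((LinearMap.exact_subtype_ker_map r).splitSurjectiveEquiv
    (LinearMap.ker r).subtype_injective ⟨s, h⟩).1⟩

theorem factorsThroughFree_id_ker {s : M →ₗ[A] N} {r : N →ₗ[A] M} (h : r ∘ₗ s = LinearMap.id)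
    (hsr : FactorsThroughFree (LinearMap.id - s ∘ₗ r)) :
    FactorsThroughFree (LinearMap.id : LinearMap.ker r →ₗ[A] LinearMap.ker r) := by
  let π : N →ₗ[A] LinearMap.ker r := (LinearMap.id - s ∘ₗ r).codRestrict _ fun x => by
    simpa [sub_eq_zero] using (LinearMap.congr_fun h (r x)).symm
  have hπ : π ∘ₗ (LinearMap.id - s ∘ₗ r) ∘ₗ (LinearMap.ker r).subtype = LinearMap.id := by
    ext ⟨k, hk⟩
    simp [π, LinearMap.mem_ker.1 hk]
  exact hπ ▸ (hsr.comp_right _).comp_left _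

theorem factorsThroughFree_id_sub_prod_comp_coprod {f : M →ₗ[A] N} {g : N →ₗ[A] M} {n : ℕ}
    (a : M →ₗ[A] Fin n → A) (b : (Fin n → A) →ₗ[A] M)
    (hfg : FactorsThroughFree (LinearMap.id - f ∘ₗ g)) :
    FactorsThroughFree (LinearMap.id - f.prod a ∘ₗ g.coprod b) := by
  have decomposition : LinearMap.id - f.prod a ∘ₗ g.coprod b =
      LinearMap.inl A N (Fin n → A) ∘ₗ (LinearMap.id - f ∘ₗ g) ∘ₗ LinearMap.fst A N _ +
        ((LinearMap.inr A N _ - f.prod a ∘ₗ b) ∘ₗ LinearMap.snd A N _ +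
          (-LinearMap.inr A N _) ∘ₗ a ∘ₗ g ∘ₗ LinearMap.fst A N _) := by
    ext <;> simp
  rw [decomposition]
  exact ((hfg.comp_right _).comp_left _).add (.add ⟨n, _, _, rfl⟩ ⟨n, _, _, rfl⟩)

theorem exists_equiv_prod_free [IsLocalRing A] [Module.Finite A N] {f : M →ₗ[A] N}
    {g : N →ₗ[A] M} (hgf : FactorsThroughFree (LinearMap.id - g ∘ₗ f))
    (hfg : FactorsThroughFree (LinearMap.id - f ∘ₗ g)) :
    ∃ (n : ℕ) (K : Submodule A (N × (Fin n → A))), K.FG ∧ Module.Free A K ∧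
      Nonempty ((N × (Fin n → A)) ≃ₗ[A] K × M) := by
  obtain ⟨n, a, b, hba⟩ := hgf
  have coprod_comp_prod : g.coprod b ∘ₗ f.prod a = LinearMap.id := by
    rw [LinearMap.coprod_comp_prod, hba, add_sub_cancel]
  obtain ⟨e⟩ := nonempty_equiv_ker_prod_of_rightInverse coprod_comp_prod
  have finite_ker : Module.Finite A (LinearMap.ker (g.coprod b)) :=
    .of_surjective (LinearMap.fst A _ M ∘ₗ e.toLinearMap)
      (Prod.fst_surjective.comp e.surjective)
  exact ⟨n, LinearMap.ker (g.coprod b), Module.Finite.iff_fg.1 finite_ker,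
    free_of_factorsThroughFree_id (factorsThroughFree_id_ker coprod_comp_prod
      (factorsThroughFree_id_sub_prod_comp_coprod a b hfg)), ⟨e⟩⟩

end StableEquivalence

section Invariance

variable {A : Type u} [CommRing A] [IsLocalRing A]

theorem ICM.mk_eq_of_equiv {M N : CM A} (e : M.obj ≃ₗ[A] N.obj) : ICM.mk M = ICM.mk N :=
  Quotient.sound ⟨(isMCM A).fullyFaithfulι.preimageIso e.toModuleIso⟩

theorem StableICM.mk_eq_of_iso {M N : Stable A} (e : M ≅ N) : StableICM.mk M = StableICM.mk N :=
  Quotient.sound ⟨e⟩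

theorem proj_map_eq_iff {M N : CM A} (f g : M ⟶ N) :
    (proj A).map f = (proj A).map g ↔ FactorsThroughFree (f.hom.hom - g.hom.hom) :=
  CategoryTheory.Quotient.functor_map_eq_iff _ _ _

theorem isZero_proj_iff (M : CM A) :
    Limits.IsZero ((proj A).obj M) ↔ Module.Free A M.obj := by
  constructor
  · intro hzero
    have id_eq_zero : (proj A).map (𝟙 M) = (proj A).map (ObjectProperty.homMk 0) :=
      hzero.eq_of_src _ _
    refine free_of_factorsThroughFree_id ?_
    rw [← sub_zero LinearMap.id]
    exact (proj_map_eq_iff _ _).1 id_eq_zero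
  · intro hfree
    refine ⟨fun Y => ⟨⟨⟨(proj A).map (Y := Y.as) (ObjectProperty.homMk 0)⟩, fun g => ?_⟩⟩,
      fun Y => ⟨⟨⟨(proj A).map (X := Y.as) (ObjectProperty.homMk 0)⟩, fun g => ?_⟩⟩⟩
    · obtain ⟨g, rfl⟩ := (proj A).map_surjective (Y := Y.as) g
      exact (proj_map_eq_iff _ _).2 (factorsThroughFree_of_free_source _)
    · obtain ⟨g, rfl⟩ := (proj A).map_surjective (X := Y.as) g
      exact (proj_map_eq_iff _ _).2 (factorsThroughFree_of_free_target _)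

theorem exists_factorsThroughFree_of_iso_proj {M N : CM A}
    (e : (proj A).obj M ≅ (proj A).obj N) :
    ∃ (f : M.obj →ₗ[A] N.obj) (g : N.obj →ₗ[A] M.obj),
      FactorsThroughFree (LinearMap.id - g ∘ₗ f) ∧ FactorsThroughFree (LinearMap.id - f ∘ₗ g) := by
  obtain ⟨f, hf⟩ := (proj A).map_surjective e.hom
  obtain ⟨g, hg⟩ := (proj A).map_surjective e.inv
  exact ⟨f.hom.hom, g.hom.hom,
    (proj_map_eq_iff (𝟙 M) (f ≫ g)).1 (by
      rw [Functor.map_comp, hf, hg, e.hom_inv_id, CategoryTheory.Functor.map_id]),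
    (proj_map_eq_iff (𝟙 N) (g ≫ f)).1 (by
      rw [Functor.map_comp, hf, hg, e.inv_hom_id, CategoryTheory.Functor.map_id])⟩

variable [IsNoetherianRing A] (hA : IsGorenstein A) {ξ : ICM A → ℤ}
  (hξ : IsPreTriangleFunction ξ)

include hA hξ

theorem IsPreTriangleFunction.sum_pi (N : CM A) (n : ℕ) :
    ξ (ICM.mk (N.sum ⟨ModuleCat.of A (Fin n → A), isMCM_pi hA n⟩)) = ξ (ICM.mk N) := by
  rw [hξ.add, (hξ.eq_zero_iff ⟨ModuleCat.of A (Fin n → A), isMCM_pi hA n⟩).2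
    (inferInstanceAs (Module.Free A (Fin n → A))), add_zero]

theorem IsPreTriangleFunction.eq_of_iso {M N : CM A} (e : (proj A).obj M ≅ (proj A).obj N) :
    ξ (ICM.mk M) = ξ (ICM.mk N) := by
  obtain ⟨f, g, hgf, hfg⟩ := exists_factorsThroughFree_of_iso_proj e
  obtain ⟨n, K, hK, hKfree, ⟨φ⟩⟩ := exists_equiv_prod_free hgf hfg
  have := Module.Finite.iff_fg.2 hK
  let K' : CM A := ⟨ModuleCat.of A K, isMCM_of_free hA K⟩
  let F : CM A := ⟨ModuleCat.of A (Fin n → A), isMCM_pi hA n⟩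
  calc ξ (ICM.mk M) = ξ (ICM.mk (K'.sum M)) := by
        rw [hξ.add, (hξ.eq_zero_iff K').2 hKfree, zero_add]
    _ = ξ (ICM.mk (N.sum F)) :=
      congrArg ξ (ICM.mk_eq_of_equiv (M := N.sum F) (N := K'.sum M) φ).symm
    _ = ξ (ICM.mk N) := hξ.sum_pi hA N n

end Invariance

section Pushout

variable {A : Type u} [CommRing A] {M N Q C : ModuleCat.{u} A} {f : M ⟶ N} {i : M ⟶ Q}
  {i' : N ⟶ C} {q : Q ⟶ C}

theorem range_coprod_eq_top_of_isPushout (h : IsPushout f i i' q) :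
    LinearMap.range (i'.hom.coprod q.hom) = ⊤ := by
  refine LinearMap.range_eq_top_of_cancel fun u v huv => ?_
  suffices ModuleCat.ofHom u = ModuleCat.ofHom v from ModuleCat.hom_ext_iff.1 this
  refine h.hom_ext ?_ ?_
  · ext n
    simpa using LinearMap.congr_fun huv (n, 0)
  · ext x
    simpa using LinearMap.congr_fun huv (0, x)

theorem ker_coprod_le_range_of_isPushout (h : IsPushout f i i' q) :
    LinearMap.ker (i'.hom.coprod q.hom) ≤ LinearMap.range (f.hom.prod (-i.hom)) := by
  let R := LinearMap.range (f.hom.prod (-i.hom))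
  have comm : f ≫ ModuleCat.ofHom (R.mkQ ∘ₗ LinearMap.inl A N Q) =
      i ≫ ModuleCat.ofHom (R.mkQ ∘ₗ LinearMap.inr A N Q) := by
    ext m
    exact (Submodule.Quotient.eq R).2 ⟨m, Prod.ext (sub_zero _).symm (zero_sub _).symm⟩
  let θ := (h.desc _ _ comm).hom
  have comp_coprod : θ ∘ₗ i'.hom.coprod q.hom = R.mkQ := by
    rw [LinearMap.comp_coprod, ← ModuleCat.hom_comp, ← ModuleCat.hom_comp, h.inl_desc,
      h.inr_desc, ModuleCat.hom_ofHom, ModuleCat.hom_ofHom, LinearMap.coprod_comp_inl_inr]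
  calc LinearMap.ker (i'.hom.coprod q.hom) ≤ LinearMap.ker (θ ∘ₗ i'.hom.coprod q.hom) :=
        LinearMap.ker_le_ker_comp _ _
    _ = R := by rw [comp_coprod, Submodule.ker_mkQ]

theorem isShortExact_prod_neg_coprod_of_isPushout
    (h : IsPushout f i i' q) (hi : Function.Injective i) :
    IsShortExact (f.hom.prod (-i.hom)) (i'.hom.coprod q.hom) where
  injective _ _ hxy := hi (neg_injective (congrArg Prod.snd hxy))
  exact := by
    refine LinearMap.exact_iff.2 (le_antisymm (ker_coprod_le_range_of_isPushout h) ?_)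
    rw [LinearMap.range_le_ker_iff, LinearMap.coprod_comp_prod, LinearMap.comp_neg,
      ← sub_eq_add_neg, sub_eq_zero]
    exact ModuleCat.hom_ext_iff.1 h.w
  surjective := LinearMap.range_eq_top.1 (range_coprod_eq_top_of_isPushout h)

end Pushout

section PushoutSquare

variable {A : Type*} [CommRing A] {M N Q C W R V : Type*} [AddCommGroup M] [Module A M]
  [AddCommGroup N] [Module A N] [AddCommGroup Q] [Module A Q] [AddCommGroup C] [Module A C]
  [AddCommGroup W] [Module A W] [AddCommGroup R] [Module A R] [AddCommGroup V] [Module A V]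

theorem IsShortExact.cobaseChange {f : M →ₗ[A] N} {i : M →ₗ[A] Q} {i' : N →ₗ[A] C}
    {q : Q →ₗ[A] C} {p : Q →ₗ[A] W} {p' : C →ₗ[A] W}
    (h : IsShortExact (f.prod (-i)) (i'.coprod q)) (hip : IsShortExact i p)
    (hN : p' ∘ₗ i' = 0) (hQ : p' ∘ₗ q = p) : IsShortExact i' p' where
  injective := by
    refine (injective_iff_map_eq_zero _).2 fun n hn => ?_
    obtain ⟨m, hm⟩ := (h.exact (n, 0)).1 (by simpa using hn)
    have hfm : f m = n := congrArg Prod.fst hm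
    have him : i m = 0 := neg_eq_zero.1 (congrArg Prod.snd hm)
    rw [← hfm, (map_eq_zero_iff i hip.injective).1 him, map_zero]
  exact := by
    refine LinearMap.exact_iff.2 (le_antisymm (fun z hz => ?_) (LinearMap.range_le_ker_iff.2 hN))
    obtain ⟨⟨n, x⟩, rfl⟩ := h.surjective z
    have hx : p x = 0 := by
      have hpi' : p' (i' n) = 0 := LinearMap.congr_fun hN n
      simpa [hpi', ← hQ] using hz
    obtain ⟨m, rfl⟩ := (hip.exact x).1 hx
    have hm : i' (f m) - q (i m) = 0 := by
      simpa [sub_eq_add_neg] using h.exact.apply_apply_eq_zero m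
    exact ⟨n + f m, by simp [sub_eq_zero.1 hm]⟩
  surjective := by
    refine Function.Surjective.of_comp (g := q) ?_
    rw [← LinearMap.coe_comp, hQ]
    exact hip.surjective

theorem IsShortExact.prod_neg_coprod {i' : N →ₗ[A] C} {p' : C →ₗ[A] W} {j : N →ₗ[A] R}
    {r : R →ₗ[A] V} (hC : IsShortExact i' p') (hR : IsShortExact j r) {θ : C →ₗ[A] R}
    {c : W →ₗ[A] V} (hθ : θ ∘ₗ i' = j) (hc : c ∘ₗ p' = r ∘ₗ θ) :
    IsShortExact (p'.prod θ) ((-c).coprod r) where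
  injective := by
    refine (injective_iff_map_eq_zero _).2 fun z hz => ?_
    obtain ⟨n, rfl⟩ := (hC.exact z).1 (congrArg Prod.fst hz)
    have hn : j n = 0 := hθ ▸ congrArg Prod.snd hz
    rw [(map_eq_zero_iff j hR.injective).1 hn, map_zero]
  exact := by
    refine LinearMap.exact_iff.2 (le_antisymm ?_ ?_)
    · rintro ⟨w, x⟩ hwx
      obtain ⟨z, rfl⟩ := hC.surjective w
      have hx : r (x - θ z) = 0 := by
        rw [map_sub, ← LinearMap.comp_apply r θ, ← hc, sub_eq_neg_add]
        exact hwx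
      obtain ⟨n, hn⟩ := (hR.exact _).1 hx
      refine ⟨z + i' n, Prod.ext ?_ ?_⟩
      · simp [hC.exact.apply_apply_eq_zero]
      · simp [← LinearMap.comp_apply θ i', hθ, hn]
    · rw [LinearMap.range_le_ker_iff, LinearMap.coprod_comp_prod, LinearMap.neg_comp, hc,
        neg_add_cancel]
  surjective v := by
    obtain ⟨x, rfl⟩ := hR.surjective v
    exact ⟨(0, x), by simp⟩

theorem IsShortExact.cobaseChange_prod_neg_coprod {f : M →ₗ[A] N} {i : M →ₗ[A] Q}
    {i' : N →ₗ[A] C} {q : Q →ₗ[A] C} {p : Q →ₗ[A] W} {p' : C →ₗ[A] W} {j : N →ₗ[A] R}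
    {r : R →ₗ[A] V} (h : IsShortExact (f.prod (-i)) (i'.coprod q)) (hip : IsShortExact i p)
    (hN : p' ∘ₗ i' = 0) (hQ : p' ∘ₗ q = p) (hR : IsShortExact j r) {θ : C →ₗ[A] R}
    {b : Q →ₗ[A] R} {c : W →ₗ[A] V} (hθN : θ ∘ₗ i' = j) (hθQ : θ ∘ₗ q = b)
    (hc : c ∘ₗ p = r ∘ₗ b) : IsShortExact (p'.prod θ) ((-c).coprod r) := by
  refine (h.cobaseChange hip hN hQ).prod_neg_coprod hR hθN
    ((LinearMap.cancel_right h.surjective).1 ?_)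
  rw [LinearMap.comp_assoc, LinearMap.comp_assoc, LinearMap.comp_coprod, LinearMap.comp_coprod,
    LinearMap.comp_coprod, LinearMap.comp_coprod, hN, hQ, hθN, hθQ, LinearMap.comp_zero,
    hR.exact.linearMap_comp_eq_zero, hc]

end PushoutSquare

section BasicTriangles

variable {A : Type u} [CommRing A] [IsLocalRing A] [IsNoetherianRing A]

section PushoutOfCosyzygyIn

variable (hA : IsGorenstein A) {M N C : CM A} {f : M ⟶ N} {i' : N ⟶ C}
  {q : ModuleCat.of A (Fin (dualRank A M.obj) → A) ⟶ C.obj}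
  (h : IsPushout f.hom (ModuleCat.ofHom (cosyzygyIn A M.obj)) i'.hom q)

include hA h

theorem isShortExact_prod_neg_cosyzygyIn :
    IsShortExact (f.hom.hom.prod (-cosyzygyIn A M.obj)) (i'.hom.hom.coprod q.hom) :=
  isShortExact_prod_neg_coprod_of_isPushout h (cosyzygyIn_injective_and_isMCM hA M.property).1

variable {hΩ : CosyzygyClosed A} {p' : C ⟶ hΩ.obj M} (hN : i'.hom ≫ p'.hom = 0)
  (hQ : q ≫ p'.hom = ModuleCat.ofHom (cosyzygyOut A M.obj))

include hN hQ

theorem isShortExact_pushout_cosyzygy : IsShortExact i'.hom.hom p'.hom.hom :=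
  (isShortExact_prod_neg_cosyzygyIn hA h).cobaseChange (isShortExact_cosyzygy hA M.property)
    (ModuleCat.hom_ext_iff.1 hN) (ModuleCat.hom_ext_iff.1 hQ)

theorem exists_isShortExact_cosyzygy_prod :
    ∃ (θ : C.obj →ₗ[A] Fin (dualRank A N.obj) → A) (c : Cosyzygy A M.obj →ₗ[A] Cosyzygy A N.obj),
      IsShortExact (p'.hom.hom.prod θ) ((-c).coprod (cosyzygyOut A N.obj)) := by
  obtain ⟨c, b, hb, hc⟩ := exists_isInduced f.hom.hom
  have comm : f.hom ≫ ModuleCat.ofHom (cosyzygyIn A N.obj) =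
      ModuleCat.ofHom (cosyzygyIn A M.obj) ≫ ModuleCat.ofHom b := ModuleCat.hom_ext hb.symm
  exact ⟨(h.desc _ _ comm).hom, c,
    (isShortExact_prod_neg_cosyzygyIn hA h).cobaseChange_prod_neg_coprod
      (isShortExact_cosyzygy hA M.property) (ModuleCat.hom_ext_iff.1 hN)
      (ModuleCat.hom_ext_iff.1 hQ) (isShortExact_cosyzygy hA N.property)
      (ModuleCat.hom_ext_iff.1 (h.inl_desc _ _ comm))
      (ModuleCat.hom_ext_iff.1 (h.inr_desc _ _ comm)) hc⟩

end PushoutOfCosyzygyIn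

variable {ξ : ICM A → ℤ} (hξ : IsPreTriangleFunction ξ)

include hξ

theorem IsPreTriangleFunction.le_of_isShortExact {M N L : CM A} {f : M.obj →ₗ[A] N.obj}
    {g : N.obj →ₗ[A] L.obj} (h : IsShortExact f g) :
    ξ (ICM.mk N) ≤ ξ (ICM.mk M) + ξ (ICM.mk L) :=
  hξ.subadd M N L f g h.injective h.exact h.surjective

variable (hA : IsGorenstein A)

include hA

theorem IsPreTriangleFunction.le_of_isShortExact_prod_pi {M N L : CM A} {n : ℕ}
    {f : M.obj →ₗ[A] N.obj × (Fin n → A)} {g : N.obj × (Fin n → A) →ₗ[A] L.obj}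
    (h : IsShortExact f g) : ξ (ICM.mk N) ≤ ξ (ICM.mk M) + ξ (ICM.mk L) := by
  rw [← hξ.sum_pi hA N n]
  exact hξ.le_of_isShortExact h

variable {M N C : CM A} {f : M ⟶ N} {i' : N ⟶ C}
  {q : ModuleCat.of A (Fin (dualRank A M.obj) → A) ⟶ C.obj}
  (h : IsPushout f.hom (ModuleCat.ofHom (cosyzygyIn A M.obj)) i'.hom q)

include h

theorem IsPreTriangleFunction.le_add_pushout : ξ (ICM.mk N) ≤ ξ (ICM.mk M) + ξ (ICM.mk C) :=
  hξ.le_of_isShortExact_prod_pi hA (isShortExact_prod_neg_cosyzygyIn hA h)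

variable {hΩ : CosyzygyClosed A} {p' : C ⟶ hΩ.obj M} (hN : i'.hom ≫ p'.hom = 0)
  (hQ : q ≫ p'.hom = ModuleCat.ofHom (cosyzygyOut A M.obj))

include hN hQ

theorem IsPreTriangleFunction.pushout_le_add_cosyzygy :
    ξ (ICM.mk C) ≤ ξ (ICM.mk N) + ξ (ICM.mk (hΩ.obj M)) :=
  hξ.le_of_isShortExact (isShortExact_pushout_cosyzygy hA h hN hQ)

theorem IsPreTriangleFunction.cosyzygy_le_add_cosyzygy :
    ξ (ICM.mk (hΩ.obj M)) ≤ ξ (ICM.mk C) + ξ (ICM.mk (hΩ.obj N)) := by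
  obtain ⟨θ, c, hθ⟩ := exists_isShortExact_cosyzygy_prod hA h hN hQ
  exact hξ.le_of_isShortExact_prod_pi hA hθ

end BasicTriangles

section StableFunction

variable {A : Type u} [CommRing A] [IsLocalRing A] [IsNoetherianRing A]

theorem cosyzygyClosed_of_isGorenstein (hA : IsGorenstein A) : CosyzygyClosed A := fun M =>
  (cosyzygyIn_injective_and_isMCM hA M.property).2

/-- The function `[M] ↦ ξ ⟨M⟩` induced on stable isomorphism classes by a pre-triangle
function `ξ`. -/
def IsPreTriangleFunction.stable (hA : IsGorenstein A) {ξ : ICM A → ℤ}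
    (hξ : IsPreTriangleFunction ξ) : StableICM A → ℤ :=
  Quotient.lift (fun M : Stable A => ξ (ICM.mk M.as)) fun _ _ ⟨e⟩ => hξ.eq_of_iso hA e

theorem IsPreTriangleFunction.isTriangleFunction_stable (hA : IsGorenstein A)
    (hΩ : CosyzygyClosed A) {ξ : ICM A → ℤ} (hξ : IsPreTriangleFunction ξ) :
    IsTriangleFunction hΩ (hξ.stable hA) where
  nonneg M := hξ.nonneg M.as
  eq_zero_iff M := (hξ.eq_zero_iff M.as).trans (isZero_proj_iff M.as).symm
  add M N := hξ.add M N
  subadd₁ := by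
    rintro T ⟨_, ⟨M, N, C, f, i', p', q, h, -, -, rfl⟩, a, b, c, -⟩
    rw [StableICM.mk_eq_of_iso a, StableICM.mk_eq_of_iso b, StableICM.mk_eq_of_iso c]
    exact hξ.le_add_pushout hA h
  subadd₂ := by
    rintro T ⟨_, ⟨M, N, C, f, i', p', q, h, hN, hQ, rfl⟩, a, b, c, -⟩
    rw [StableICM.mk_eq_of_iso b, StableICM.mk_eq_of_iso c,
      StableICM.mk_eq_of_iso ((translation hΩ).mapIso a)]
    exact hξ.pushout_le_add_cosyzygy hA h hN hQ
  subadd₃ := by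
    rintro T ⟨_, ⟨M, N, C, f, i', p', q, h, hN, hQ, rfl⟩, a, b, c, -⟩
    rw [StableICM.mk_eq_of_iso c, StableICM.mk_eq_of_iso ((translation hΩ).mapIso a),
      StableICM.mk_eq_of_iso ((translation hΩ).mapIso b)]
    exact hξ.cosyzygy_le_add_cosyzygy hA h hN hQ

end StableFunction

end StableCM

theorem mainTheorem6 {A : Type u} [CommRing A] [IsLocalRing A] [IsNoetherianRing A]
    (hA : StableCM.IsGorenstein A) :
    ∃ hΩ : StableCM.CosyzygyClosed A,
      ∀ ξ : StableCM.ICM A → ℤ, StableCM.IsPreTriangleFunction ξ →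
        ∃ ξ' : StableCM.StableICM A → ℤ,
          (∀ M : StableCM.CM A, ξ' (StableCM.StableICM.mk ((StableCM.proj A).obj M)) =
            ξ (StableCM.ICM.mk M)) ∧
          StableCM.IsTriangleFunction hΩ ξ' :=
  ⟨StableCM.cosyzygyClosed_of_isGorenstein hA, fun _ hξ =>
    ⟨hξ.stable hA, fun _ => rfl, hξ.isTriangleFunction_stable hA _⟩⟩
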